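/- Let $y_j=\theta_j+\sigma\xi_j$, $j=1,\dots,d$, where $\theta\in\mathbb R^d$ is unknown, $\sigma>0$, and the $\xi_j$ are i.i.d. standard normal; $\mathbf E_\theta$ is the expectation under the law of $y=(y_1,\dots,y_d)$. For $q,r>0$ let $\|\theta\|_q=\big(\sum_{j=1}^d|\theta_j|^q\big)^{1/q}$ and $B_q(r)=\{\theta\in\mathbb R^d:\|\theta\|_q\le r\}$, and let $$R^*=\inf_{\hat T}\ \sup_{\theta\in B_q(r)}\mathbf E_\theta(\hat T-\|\theta\|_2)^2$$ be the minimax risk, the infimum being over all estimators, i.e. all measurable functions $\hat T=\hat T(y)$. Let $m=m(d,r,\sigma,q)$ be the largest integer $s\ge1$ such that $$\sigma^2\log(1+d/k^2)\le r^2k^{-2/q}\qquad\text{for all integers } 1\le k\le s,$$ with $m=0$ if the inequality fails for $k=1$ and $m=\infty$ if it holds for all $k\ge1$. (For $q\le1$ the integers that satisfy the inequality form an initial segment of $\{1,2,\dots\}$, so that $m$ is the largest integer satisfying it.) Put $$\psi=\begin{cases}\sigma^2\sqrt d & \text{if } m>\sqrt d,\\ \sigma^2m\log(1+d/m^2)&\text{if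 }1\le m\le\sqrt d,\\ r^2&\text{if } m=0,\end{cases}$$ $$\hat Q_q=\begin{cases}\sum_{j=1}^d y_j^2-d\sigma^2&\text{if } m>\sqrt d,\\ \sum_{j=1}^d (y_j^2-\tilde\alpha_m\sigma^2)\,\mathbf 1_{\{|y_j|>2\sigma\sqrt{2\log(1+d/m^2)}\}}&\text{if }1\le m\le\sqrt d,\\ 0&\text{if } m=0,\end{cases}$$ where $\tilde\alpha_m=\mathbf E\big(X^2\mid X^2>8\log(1+d/m^2)\big)$ with $X$ standard normal, and let $\hat N_q=\sqrt{\max(\hat Q_q,0)}$. Theorem. Let $0<q<2$. There exist constants $C,c>0$, depending only on $q$, such that for every integer $d\ge1$ and all $r,\sigma>0$ the statistic $\hat N_q$ is measurable, $$\sup_{\theta\in B_q(r)}\mathbf E_\theta(\hat N_q-\|\theta\|_2)^2\le C\,\psi,\qquad\text{and}\qquad R^*\ge c\,\psi .$$ -/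

import Mathlib

open MeasureTheory ProbabilityTheory
open scoped ENNReal

namespace SparseNorm

noncomputable section

/-- The law `P_θ` of the observations `y_j = θ_j + σ ξ_j`, `j = 1, …, d`, where the `ξ_j` are
i.i.d. standard normal. -/
def obsLaw {d : ℕ} (σ : ℝ) (θ : Fin d → ℝ) : Measure (Fin d → ℝ) :=
  (Measure.pi fun _ : Fin d => gaussianReal 0 1).map fun ξ j => θ j + σ * ξ j

/-- `‖θ‖_q = (∑ |θ_j|^q)^(1/q)`. -/
def lqNorm {d : ℕ} (q : ℝ) (θ : Fin d → ℝ) : ℝ :=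
  (∑ j, |θ j| ^ q) ^ (1 / q)

/-- The class `B_q(r)` in `ℝ^d`. -/
def lqBall (d : ℕ) (q r : ℝ) : Set (Fin d → ℝ) :=
  {θ | lqNorm q θ ≤ r}

/-- The functional `‖θ‖_2 = √(∑ θ_j²)`. -/
def l2Norm {d : ℕ} (θ : Fin d → ℝ) : ℝ :=
  √(∑ j, θ j ^ 2)

/-- The squared risk `E_θ (T̂ - T(θ))²`, as an element of `[0, ∞]`. -/
def sqRisk {d : ℕ} (σ : ℝ) (T : (Fin d → ℝ) → ℝ) (That : (Fin d → ℝ) → ℝ)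
    (θ : Fin d → ℝ) : ℝ≥0∞ :=
  ∫⁻ y, ENNReal.ofReal ((That y - T θ) ^ 2) ∂(obsLaw σ θ)

/-- The maximum squared risk over a class `Θ`. -/
def maxRisk {d : ℕ} (σ : ℝ) (T : (Fin d → ℝ) → ℝ) (Θ : Set (Fin d → ℝ))
    (That : (Fin d → ℝ) → ℝ) : ℝ≥0∞ :=
  ⨆ θ ∈ Θ, sqRisk σ T That θ

/-- The minimax risk: the infimum of the maximum risk over all estimators, that is, over all
measurable functions of the observations. -/
def minimaxRisk {d : ℕ} (σ : ℝ) (T : (Fin d → ℝ) → ℝ) (Θ : Set (Fin d → ℝ)) : ℝ≥0∞ :=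
  ⨅ (That : (Fin d → ℝ) → ℝ) (_ : Measurable That), maxRisk σ T Θ That

/-- The inequality `σ² log (1 + d / s²) ≤ r² s^(-2/q)`. -/
def SparsityIneq (d : ℕ) (q r σ : ℝ) (s : ℕ) : Prop :=
  σ ^ 2 * Real.log (1 + d / (s : ℝ) ^ 2) ≤ r ^ 2 * (s : ℝ) ^ (-2 / q)

/-- The effective sparsity `m`: the largest `s ≥ 1` such that `SparsityIneq` holds at all of
`1, …, s`; it is `0` if `SparsityIneq` fails at `1`, and `⊤` if it never fails.
For `q ≤ 1` the left side of `SparsityIneq` times `s^(2/q)` is increasing in `s`, and `m` is just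
the largest `s ≥ 1` for which `SparsityIneq` holds. For `q > 1` it holds for all large `s`. -/
def effSparsity (d : ℕ) (q r σ : ℝ) : ℕ∞ :=
  ⨆ (s : ℕ) (_ : ∀ k : ℕ, 1 ≤ k → k ≤ s → SparsityIneq d q r σ k), (s : ℕ∞)

open Classical in
/-- The rate: `σ² √d` if `m > √d` (that is, `d < m²`), `σ² m log (1 + d / m²)` if `1 ≤ m ≤ √d`,
and `r²` if `m = 0`. -/
def rate (d : ℕ) (q r σ : ℝ) : ℝ :=
  if (d : ℕ∞) < effSparsity d q r σ ^ 2 then σ ^ 2 * √(d : ℝ)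
  else if 1 ≤ effSparsity d q r σ then
    σ ^ 2 * ((effSparsity d q r σ).toNat : ℝ) *
      Real.log (1 + d / ((effSparsity d q r σ).toNat : ℝ) ^ 2)
  else r ^ 2

/-- `E (X² | X² > 8 log (1 + d / m²))` for a standard normal `X`. -/
def condSecondMoment (d m : ℕ) : ℝ :=
  ∫ x, x ^ 2 ∂(ProbabilityTheory.cond (gaussianReal 0 1)
    {x : ℝ | 8 * Real.log (1 + d / (m : ℝ) ^ 2) < x ^ 2})

open Classical in
/-- The statistic `Q̂_q`. -/
def quadStat (d : ℕ) (q r σ : ℝ) (y : Fin d → ℝ) : ℝ :=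
  if (d : ℕ∞) < effSparsity d q r σ ^ 2 then (∑ j, y j ^ 2) - d * σ ^ 2
  else if 1 ≤ effSparsity d q r σ then
    ∑ j, if 2 * σ * √(2 * Real.log (1 + d / ((effSparsity d q r σ).toNat : ℝ) ^ 2)) < |y j|
      then y j ^ 2 - condSecondMoment d (effSparsity d q r σ).toNat * σ ^ 2
      else 0
  else 0

/-- The estimator `N̂_q = √(max (Q̂_q, 0))`. -/
def normStat (d : ℕ) (q r σ : ℝ) (y : Fin d → ℝ) : ℝ :=
  √(max (quadStat d q r σ y) 0)

end

end SparseNorm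

/-!
Dividing by `σ` reduces everything to unit noise. Write `L = log (1 + d / m²)`.

*Upper bound.* If `Z` estimates `‖θ‖²`, then `(√Z₊ - ‖θ‖)²` is at most both `|Z - ‖θ‖²|` and
`(Z - ‖θ‖²)² / ‖θ‖²`, so a mean square error of order `A² + A ‖θ‖²` for `Z` gives a risk of order
`A` for `√Z₊`. For `∑ (y_j² - 1)` this holds with `A = √d`. For the thresholded sum it holds with
`A = m L`: a coordinate `t` contributes a bias of order `min (t², L)`, and maximality of `m` forces
`∑ min (θ_j², L) ≤ (m + 1) L` on the `ℓ_q` ball, while its variance is of order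
`L² exp (-L) + L t²`, and `d exp (-L) ≤ m²`. The constant `α̃_m` makes the bias vanish at `t = 0`;
since a threshold rule is even, `N(t, 1)` may be symmetrized, and then its density with respect to
`N(0, 1)` differs from `1` only to order `t²`.

*Lower bound.* The origin is compared with the uniform mixture of the vectors that have one entry
`a` in each of `k` disjoint blocks of `⌊d / k⌋` coordinates. These vectors have norm `a √k`, and the
`χ²` divergence of the mixture stays bounded as long as `a² ≤ log (1 + d / k²) / 4`.
-/

namespace SparseNorm

section FuzzyHypotheses

variable {X κ : Type*} [MeasurableSpace X] {P : Measure X}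

lemma mul_le_sq_add_sq_mul (l s ρ : ℝ) {x : ℝ} (hx : 0 ≤ x) :
    2 * l * ρ ^ 2 * x ≤ s ^ 2 + (s - ρ) ^ 2 * x + l ^ 2 * ρ ^ 2 * (x + x ^ 2) := by
  have key : (1 + x) * (s ^ 2 + (s - ρ) ^ 2 * x + l ^ 2 * ρ ^ 2 * (x + x ^ 2)
        - 2 * l * ρ ^ 2 * x)
      = ((1 + x) * s - ρ * x) ^ 2 + ρ ^ 2 * x * (1 - l * (1 + x)) ^ 2 := by ring
  have hprod : 0 ≤ (1 + x) * (s ^ 2 + (s - ρ) ^ 2 * x + l ^ 2 * ρ ^ 2 * (x + x ^ 2)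
      - 2 * l * ρ ^ 2 * x) := by
    rw [key]
    positivity
  linarith [nonneg_of_mul_nonneg_right hprod (by linarith)]

lemma ofReal_mul_le_sq_add_sq_mul {l : ℝ} (hl : 0 ≤ l) (s ρ : ℝ) (x : ℝ≥0∞) :
    ENNReal.ofReal (2 * l * ρ ^ 2) * x ≤ ENNReal.ofReal (s ^ 2)
      + ENNReal.ofReal ((s - ρ) ^ 2) * x + ENNReal.ofReal (l ^ 2 * ρ ^ 2) * (x + x ^ 2) := by
  induction x with
  | top =>
    rcases eq_or_ne (l * ρ) 0 with h | h
    · simp [mul_assoc, sq, ← mul_assoc l, h]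
    · have : ENNReal.ofReal (l ^ 2 * ρ ^ 2) ≠ 0 := by
        rw [← mul_pow]; exact (ENNReal.ofReal_pos.2 (by positivity)).ne'
      simp [ENNReal.mul_top this]
  | coe x =>
    have h := ENNReal.ofReal_le_ofReal (mul_le_sq_add_sq_mul l s ρ x.coe_nonneg)
    rwa [ENNReal.ofReal_mul (by positivity), ENNReal.ofReal_add (by positivity) (by positivity),
      ENNReal.ofReal_add (by positivity) (by positivity), ENNReal.ofReal_mul (sq_nonneg _),
      ENNReal.ofReal_mul (p := l ^ 2 * ρ ^ 2) (by positivity), ENNReal.ofReal_add (by positivity)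
      (by positivity), ENNReal.ofReal_pow x.coe_nonneg, ENNReal.ofReal_coe_nnreal] at h

lemma le_lintegral_sq_add_lintegral_withDensity [IsProbabilityMeasure P] {F : X → ℝ≥0∞}
    (hF : Measurable F) (hF₁ : ∫⁻ x, F x ∂P = 1) {M : ℝ} (hM₀ : 0 ≤ M)
    (hM : ∫⁻ x, F x ^ 2 ∂P ≤ ENNReal.ofReal M) {S : X → ℝ} (hS : Measurable S) (ρ : ℝ) :
    ENNReal.ofReal (ρ ^ 2 / (1 + M)) ≤ ∫⁻ x, ENNReal.ofReal (S x ^ 2) ∂P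
      + ∫⁻ x, ENNReal.ofReal ((S x - ρ) ^ 2) ∂(P.withDensity F) := by
  set l : ℝ := (1 + M)⁻¹ with hl
  have hl₀ : 0 ≤ l := by positivity
  have hlM : l ^ 2 * ρ ^ 2 * (1 + M) = ρ ^ 2 / (1 + M) := by rw [hl]; field_simp
  have hbound : ENNReal.ofReal (2 * l * ρ ^ 2) ≤ ∫⁻ x, ENNReal.ofReal (S x ^ 2) ∂P
      + ∫⁻ x, ENNReal.ofReal ((S x - ρ) ^ 2) ∂(P.withDensity F)
      + ENNReal.ofReal (ρ ^ 2 / (1 + M)) :=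
    calc ENNReal.ofReal (2 * l * ρ ^ 2)
        = ∫⁻ x, ENNReal.ofReal (2 * l * ρ ^ 2) * F x ∂P := by
          rw [lintegral_const_mul _ hF, hF₁, mul_one]
      _ ≤ ∫⁻ x, (ENNReal.ofReal (S x ^ 2) + ENNReal.ofReal ((S x - ρ) ^ 2) * F x
            + ENNReal.ofReal (l ^ 2 * ρ ^ 2) * (F x + F x ^ 2)) ∂P :=
          lintegral_mono fun x => ofReal_mul_le_sq_add_sq_mul hl₀ _ _ _
      _ = ∫⁻ x, ENNReal.ofReal (S x ^ 2) ∂P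
            + ∫⁻ x, ENNReal.ofReal ((S x - ρ) ^ 2) ∂(P.withDensity F)
            + ENNReal.ofReal (l ^ 2 * ρ ^ 2) * (1 + ∫⁻ x, F x ^ 2 ∂P) := by
          rw [lintegral_add_left (by fun_prop), lintegral_add_left (by fun_prop),
            lintegral_const_mul _ (by fun_prop), lintegral_add_left hF, hF₁,
            lintegral_withDensity_eq_lintegral_mul _ hF (by fun_prop)]
          simp only [Pi.mul_apply, mul_comm]
      _ ≤ _ := by
          rw [← hlM, ENNReal.ofReal_mul (q := 1 + M) (by positivity),
            ENNReal.ofReal_add zero_le_one hM₀, ENNReal.ofReal_one]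
          gcongr
  have hsplit : ENNReal.ofReal (2 * l * ρ ^ 2)
      = ENNReal.ofReal (ρ ^ 2 / (1 + M)) + ENNReal.ofReal (ρ ^ 2 / (1 + M)) := by
    rw [← ENNReal.ofReal_add (by positivity) (by positivity), hl]
    congr 1
    ring
  rw [hsplit] at hbound
  exact (ENNReal.add_le_add_iff_right ENNReal.ofReal_ne_top).1 hbound

variable [Fintype κ]

/-- The average of a finite family of densities: the density of the uniform mixture of the
corresponding measures. -/
noncomputable def averageDensity (f : κ → X → ℝ≥0∞) (x : X) : ℝ≥0∞ :=
  (Fintype.card κ : ℝ≥0∞)⁻¹ * ∑ i, f i x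

@[fun_prop]
lemma measurable_averageDensity {f : κ → X → ℝ≥0∞} (hf : ∀ i, Measurable (f i)) :
    Measurable (averageDensity f) := by
  unfold averageDensity
  fun_prop

lemma lintegral_withDensity_averageDensity {f : κ → X → ℝ≥0∞} (hf : ∀ i, Measurable (f i))
    {g : X → ℝ≥0∞} (hg : Measurable g) :
    ∫⁻ x, g x ∂(P.withDensity (averageDensity f))
      = (Fintype.card κ : ℝ≥0∞)⁻¹ * ∑ i, ∫⁻ x, g x ∂(P.withDensity (f i)) := by
  simp_rw [lintegral_withDensity_eq_lintegral_mul _ (measurable_averageDensity hf) hg,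
    lintegral_withDensity_eq_lintegral_mul _ (hf _) hg, Pi.mul_apply]
  rw [← lintegral_finsetSum _ fun i _ => by fun_prop, ← lintegral_const_mul _ (by fun_prop)]
  simp only [averageDensity, mul_assoc, Finset.sum_mul]

lemma lintegral_averageDensity_sq {f : κ → X → ℝ≥0∞} (hf : ∀ i, Measurable (f i)) :
    ∫⁻ x, averageDensity f x ^ 2 ∂P = ((Fintype.card κ : ℝ≥0∞)⁻¹) ^ 2
      * ∑ i, ∑ j, ∫⁻ x, f i x * f j x ∂P := by
  have hsum : ∀ i, ∑ j, ∫⁻ x, f i x * f j x ∂P = ∫⁻ x, ∑ j, f i x * f j x ∂P := fun i =>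
    (lintegral_finsetSum _ fun j _ => (hf i).mul (hf j)).symm
  simp_rw [hsum]
  rw [← lintegral_finsetSum _ fun i _ => by fun_prop, ← lintegral_const_mul _ (by fun_prop)]
  simp only [averageDensity, mul_pow, sq (∑ i, f i _), Finset.sum_mul_sum]

lemma inv_card_mul_sum_le [Nonempty κ] {a : κ → ℝ≥0∞} {b : ℝ≥0∞} (h : ∀ i, a i ≤ b) :
    (Fintype.card κ : ℝ≥0∞)⁻¹ * ∑ i, a i ≤ b := by
  rw [mul_comm, ← div_eq_mul_inv]
  refine ENNReal.div_le_of_le_mul' ?_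
  calc ∑ i, a i ≤ ∑ _i : κ, b := Finset.sum_le_sum fun i _ => h i
    _ = Fintype.card κ * b := by rw [Finset.sum_const, Finset.card_univ, nsmul_eq_mul]

theorem le_of_forall_lintegral_withDensity_le [IsProbabilityMeasure P] [Nonempty κ]
    {f : κ → X → ℝ≥0∞} (hf : ∀ i, Measurable (f i)) (hf₁ : ∀ i, ∫⁻ x, f i x ∂P = 1)
    {M : ℝ} (hM₀ : 0 ≤ M)
    (hM : ∑ i, ∑ j, ∫⁻ x, f i x * f j x ∂P ≤ ENNReal.ofReal M * (Fintype.card κ) ^ 2)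
    {S : X → ℝ} (hS : Measurable S) {ρ : ℝ} {R : ℝ≥0∞}
    (h₀ : ∫⁻ x, ENNReal.ofReal (S x ^ 2) ∂P ≤ R)
    (h₁ : ∀ i, ∫⁻ x, ENNReal.ofReal ((S x - ρ) ^ 2) ∂(P.withDensity (f i)) ≤ R) :
    ENNReal.ofReal (ρ ^ 2 / (2 * (1 + M))) ≤ R := by
  have hcard₀ : (Fintype.card κ : ℝ≥0∞) ≠ 0 := by simp
  have hcard : (Fintype.card κ : ℝ≥0∞) ≠ ∞ := by simp
  have hmass : ∫⁻ x, averageDensity f x ∂P = 1 := by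
    have h := lintegral_withDensity_averageDensity (P := P) hf (measurable_const (a := 1))
    simpa [hf₁, ENNReal.inv_mul_cancel hcard₀ hcard] using h
  have hsecond : ∫⁻ x, averageDensity f x ^ 2 ∂P ≤ ENNReal.ofReal M := by
    rw [lintegral_averageDensity_sq hf, ← ENNReal.inv_pow, mul_comm, ← div_eq_mul_inv]
    exact ENNReal.div_le_of_le_mul hM
  have hsum : ENNReal.ofReal (ρ ^ 2 / (1 + M)) ≤ R + R := by
    refine (le_lintegral_sq_add_lintegral_withDensity (measurable_averageDensity hf) hmass hM₀
      hsecond hS ρ).trans (add_le_add h₀ ?_)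
    rw [lintegral_withDensity_averageDensity hf (by fun_prop)]
    exact inv_card_mul_sum_le h₁
  have hhalf : ρ ^ 2 / (2 * (1 + M)) = ρ ^ 2 / (1 + M) / 2 := by field_simp
  rw [hhalf, ENNReal.ofReal_div_of_pos two_pos, ENNReal.ofReal_ofNat]
  exact ENNReal.div_le_of_le_mul (by rwa [mul_two])

end FuzzyHypotheses

section ProductDensities

variable {ι : Type*} [Fintype ι] {α : ι → Type*} [∀ i, MeasurableSpace (α i)]
  {μ : ∀ i, Measure (α i)} [∀ i, IsProbabilityMeasure (μ i)]

lemma lintegral_pi_prod {f : ∀ i, α i → ℝ≥0∞} (hf : ∀ i, Measurable (f i)) :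
    ∫⁻ x, ∏ i, f i (x i) ∂(Measure.pi μ) = ∏ i, ∫⁻ y, f i y ∂(μ i) := by
  refine (lintegral_prod_eq_prod_lintegral_of_indepFun Finset.univ
    (fun i (x : ∀ i, α i) => f i (x i))
    (iIndepFun_pi fun i => (hf i).aemeasurable)
    fun i => (hf i).comp (measurable_pi_apply i)).trans ?_
  exact Finset.prod_congr rfl fun i _ => (measurePreserving_eval μ i).lintegral_comp (hf i)

lemma pi_withDensity {f : ∀ i, α i → ℝ≥0∞} (hf : ∀ i, Measurable (f i))
    [∀ i, SigmaFinite ((μ i).withDensity (f i))] :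
    Measure.pi (fun i => (μ i).withDensity (f i))
      = (Measure.pi μ).withDensity fun x => ∏ i, f i (x i) := by
  classical
  refine Measure.pi_eq fun s hs => ?_
  have hindicator : (Set.univ.pi s).indicator (fun x => ∏ i, f i (x i))
      = fun x => ∏ i, (s i).indicator (f i) (x i) := by
    ext x
    simp only [Set.indicator_apply, Finset.prod_ite_zero, Set.mem_univ_pi, Finset.mem_univ,
      true_imp_iff]
  rw [withDensity_apply _ (MeasurableSet.univ_pi hs),
    ← lintegral_indicator (MeasurableSet.univ_pi hs), hindicator,
    lintegral_pi_prod fun i => (hf i).indicator (hs i)]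
  simp only [lintegral_indicator (hs _), withDensity_apply _ (hs _)]

end ProductDensities

section GaussianShift

open Matrix

variable {ι : Type*} [Fintype ι]

/-- The law of a standard Gaussian vector translated by `t`. -/
noncomputable def gaussianShift (t : ι → ℝ) : Measure (ι → ℝ) :=
  Measure.pi fun j => gaussianReal (t j) 1

instance (t : ι → ℝ) : IsProbabilityMeasure (gaussianShift t) := by
  unfold gaussianShift
  infer_instance

/-- The density of `gaussianShift t` with respect to `gaussianShift 0`. -/
noncomputable def likelihood (t x : ι → ℝ) : ℝ≥0∞ :=
  ENNReal.ofReal (Real.exp (t ⬝ᵥ x - t ⬝ᵥ t / 2))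

@[fun_prop]
lemma measurable_likelihood (t : ι → ℝ) : Measurable (likelihood t) := by
  unfold likelihood dotProduct
  fun_prop

lemma gaussianReal_eq_withDensity (t : ℝ) :
    gaussianReal t 1 = (gaussianReal 0 1).withDensity
      fun x => ENNReal.ofReal (Real.exp (t * x - t * t / 2)) := by
  rw [gaussianReal_of_var_ne_zero _ one_ne_zero, gaussianReal_of_var_ne_zero _ one_ne_zero,
    ← withDensity_mul _ (measurable_gaussianPDF 0 1) (by fun_prop)]
  congr 1
  ext x
  simp only [gaussianPDF, Pi.mul_apply]
  rw [← ENNReal.ofReal_mul (gaussianPDFReal_nonneg _ _ _)]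
  simp only [gaussianPDFReal, mul_assoc, ← Real.exp_add, NNReal.coe_one]
  ring_nf

lemma gaussianShift_eq_withDensity (t : ι → ℝ) :
    gaussianShift t = (gaussianShift 0).withDensity (likelihood t) := by
  have hprod : likelihood t
      = fun x => ∏ j, ENNReal.ofReal (Real.exp (t j * x j - t j * t j / 2)) := by
    ext x
    rw [likelihood, ← ENNReal.ofReal_prod_of_nonneg fun _ _ => (Real.exp_pos _).le,
      ← Real.exp_sum]
    simp only [dotProduct, Finset.sum_sub_distrib, Finset.sum_div]
  have (j : ι) : IsProbabilityMeasure ((gaussianReal 0 1).withDensity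
      fun x => ENNReal.ofReal (Real.exp (t j * x - t j * t j / 2))) := by
    rw [← gaussianReal_eq_withDensity]
    infer_instance
  rw [hprod]
  simp only [gaussianShift, Pi.zero_apply, gaussianReal_eq_withDensity (t _)]
  exact pi_withDensity fun j => by fun_prop

lemma lintegral_likelihood (t : ι → ℝ) : ∫⁻ x, likelihood t x ∂(gaussianShift 0) = 1 := by
  rw [← setLIntegral_univ, ← withDensity_apply _ MeasurableSet.univ,
    ← gaussianShift_eq_withDensity, measure_univ]

lemma likelihood_mul (s t x : ι → ℝ) :
    likelihood s x * likelihood t x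
      = ENNReal.ofReal (Real.exp (s ⬝ᵥ t)) * likelihood (s + t) x := by
  simp only [likelihood, ← ENNReal.ofReal_mul (Real.exp_pos _).le, ← Real.exp_add,
    add_dotProduct, dotProduct_add, dotProduct_comm t s]
  ring_nf

lemma lintegral_likelihood_mul (s t : ι → ℝ) :
    ∫⁻ x, likelihood s x * likelihood t x ∂(gaussianShift 0)
      = ENNReal.ofReal (Real.exp (s ⬝ᵥ t)) := by
  simp_rw [likelihood_mul]
  rw [lintegral_const_mul _ (measurable_likelihood _), lintegral_likelihood, mul_one]

theorem le_of_forall_lintegral_gaussianShift_le {κ : Type*} [Fintype κ] [Nonempty κ]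
    (t : κ → ι → ℝ) {M : ℝ} (hM₀ : 0 ≤ M)
    (hM : ∑ i, ∑ j, Real.exp (t i ⬝ᵥ t j) ≤ M * (Fintype.card κ) ^ 2)
    {S : (ι → ℝ) → ℝ} (hS : Measurable S) {ρ : ℝ} {R : ℝ≥0∞}
    (h₀ : ∫⁻ x, ENNReal.ofReal (S x ^ 2) ∂(gaussianShift 0) ≤ R)
    (h₁ : ∀ i, ∫⁻ x, ENNReal.ofReal ((S x - ρ) ^ 2) ∂(gaussianShift (t i)) ≤ R) :
    ENNReal.ofReal (ρ ^ 2 / (2 * (1 + M))) ≤ R := by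
  refine le_of_forall_lintegral_withDensity_le (f := fun i => likelihood (t i))
    (fun i => measurable_likelihood _) (fun i => lintegral_likelihood _) hM₀ ?_ hS h₀
    fun i => gaussianShift_eq_withDensity (t i) ▸ h₁ i
  simp_rw [lintegral_likelihood_mul, ← ENNReal.ofReal_natCast (Fintype.card κ),
    ← ENNReal.ofReal_pow (Nat.cast_nonneg (Fintype.card κ)), ← ENNReal.ofReal_mul hM₀,
    ← ENNReal.ofReal_sum_of_nonneg fun _ _ => (Real.exp_pos _).le]
  rw [← ENNReal.ofReal_sum_of_nonneg fun _ _ => Finset.sum_nonneg fun _ _ => (Real.exp_pos _).le]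
  exact ENNReal.ofReal_le_ofReal hM

end GaussianShift

section Scaling

variable {d : ℕ}

lemma obsLaw_smul (σ : ℝ) (t : Fin d → ℝ) :
    obsLaw σ (σ • t) = (gaussianShift t).map fun x => σ • x := by
  have htranslate : gaussianShift t
      = (Measure.pi fun _ : Fin d => gaussianReal 0 1).map fun ξ j => t j + ξ j := by
    rw [Measure.pi_map_pi (f := fun j x => t j + x) fun j => by fun_prop]
    simp only [gaussianShift, gaussianReal_map_const_add, zero_add]
  rw [htranslate, Measure.map_map (by fun_prop) (by fun_prop), obsLaw]
  congr 1
  ext ξ j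
  simp [mul_add]

lemma sqRisk_smul (σ : ℝ) (T : (Fin d → ℝ) → ℝ) {That : (Fin d → ℝ) → ℝ}
    (hThat : Measurable That) (t : Fin d → ℝ) :
    sqRisk σ T That (σ • t)
      = ∫⁻ x, ENNReal.ofReal ((That (σ • x) - T (σ • t)) ^ 2) ∂(gaussianShift t) := by
  rw [sqRisk, obsLaw_smul, lintegral_map (by fun_prop) (by fun_prop)]

lemma l2Norm_smul {σ : ℝ} (hσ : 0 ≤ σ) (t : Fin d → ℝ) : l2Norm (σ • t) = σ * l2Norm t := by
  simp only [l2Norm, Pi.smul_apply, smul_eq_mul, mul_pow, ← Finset.mul_sum]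
  rw [Real.sqrt_mul (sq_nonneg σ), Real.sqrt_sq hσ]

lemma maxRisk_le_of_smul {σ : ℝ} (hσ : 0 < σ) {T That : (Fin d → ℝ) → ℝ}
    (hThat : Measurable That) {Θ : Set (Fin d → ℝ)} {R : ℝ≥0∞}
    (h : ∀ t, σ • t ∈ Θ →
      ∫⁻ x, ENNReal.ofReal ((That (σ • x) - T (σ • t)) ^ 2) ∂(gaussianShift t) ≤ R) :
    maxRisk σ T Θ That ≤ R := by
  refine iSup₂_le fun θ hθ => ?_
  rw [← smul_inv_smul₀ hσ.ne' θ] at hθ ⊢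
  rw [sqRisk_smul σ T hThat]
  exact h _ hθ

end Scaling

section LqBall

variable {d : ℕ} {q r : ℝ}

lemma mem_lqBall_iff (hq : 0 < q) (hr : 0 ≤ r) {θ : Fin d → ℝ} :
    θ ∈ lqBall d q r ↔ ∑ j, |θ j| ^ q ≤ r ^ q := by
  have hsum : 0 ≤ ∑ j, |θ j| ^ q := by positivity
  change lqNorm q θ ≤ r ↔ _
  rw [lqNorm, one_div, Real.rpow_inv_le_iff_of_pos hsum hr hq]

lemma le_sq_mul_rpow_iff (hq : 0 < q) (hr : 0 ≤ r) {s u : ℝ} (hs : 0 < s) (hu : 0 ≤ u) :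
    u ≤ r ^ 2 * s ^ (-2 / q) ↔ s * u ^ (q / 2) ≤ r ^ q := by
  have hpow : (r ^ 2 * s ^ (-2 / q)) ^ (q / 2) = s⁻¹ * r ^ q := by
    rw [Real.mul_rpow (sq_nonneg r) (by positivity), ← Real.rpow_natCast, ← Real.rpow_mul hr,
      ← Real.rpow_mul hs.le, mul_comm, ← Real.rpow_neg_one]
    congr 2 <;> push_cast <;> field_simp
  rw [← Real.rpow_le_rpow_iff hu (by positivity) (half_pos hq), hpow, le_inv_mul_iff₀ hs]

lemma abs_rpow_eq_sq_rpow_half (x q : ℝ) : |x| ^ q = (x ^ 2) ^ (q / 2) := by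
  rw [← sq_abs, ← Real.rpow_natCast, ← Real.rpow_mul (abs_nonneg x)]
  congr 1
  push_cast
  ring

lemma min_sq_le_abs_rpow_mul (hq : 0 < q) (hq₂ : q ≤ 2) (x : ℝ) {u : ℝ} (hu : 0 < u) :
    min (x ^ 2) u ≤ |x| ^ q * u ^ (1 - q / 2) := by
  have hmin : 0 ≤ min (x ^ 2) u := le_min (sq_nonneg x) hu.le
  rcases hmin.eq_or_lt' with h | h
  · rw [h]
    positivity
  · calc min (x ^ 2) u = min (x ^ 2) u ^ (q / 2) * min (x ^ 2) u ^ (1 - q / 2) := by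
          rw [← Real.rpow_add h, add_sub_cancel, Real.rpow_one]
      _ ≤ (x ^ 2) ^ (q / 2) * u ^ (1 - q / 2) :=
          mul_le_mul (Real.rpow_le_rpow hmin (min_le_left _ _) (half_pos hq).le)
            (Real.rpow_le_rpow hmin (min_le_right _ _) (by linarith)) (by positivity)
            (by positivity)
      _ = |x| ^ q * u ^ (1 - q / 2) := by rw [abs_rpow_eq_sq_rpow_half]

lemma sum_min_sq_le (hq : 0 < q) (hq₂ : q ≤ 2) (hr : 0 ≤ r) {θ : Fin d → ℝ}
    (hθ : θ ∈ lqBall d q r) {u : ℝ} (hu : 0 < u) :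
    ∑ j, min (θ j ^ 2) u ≤ r ^ q * u ^ (1 - q / 2) :=
  calc ∑ j, min (θ j ^ 2) u ≤ ∑ j, |θ j| ^ q * u ^ (1 - q / 2) :=
        Finset.sum_le_sum fun j _ => min_sq_le_abs_rpow_mul hq hq₂ (θ j) hu
    _ = (∑ j, |θ j| ^ q) * u ^ (1 - q / 2) := (Finset.sum_mul _ _ _).symm
    _ ≤ r ^ q * u ^ (1 - q / 2) := by
        gcongr
        exact (mem_lqBall_iff hq hr).1 hθ

lemma sum_sq_le_of_mem_lqBall (hq : 0 < q) (hq₂ : q ≤ 2) (hr : 0 < r) {θ : Fin d → ℝ}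
    (hθ : θ ∈ lqBall d q r) : ∑ j, θ j ^ 2 ≤ r ^ 2 := by
  have habs (j : Fin d) : |θ j| ≤ r := by
    have hj : |θ j| ^ q ≤ r ^ q :=
      (Finset.single_le_sum (f := fun j => |θ j| ^ q) (fun _ _ => by positivity)
        (Finset.mem_univ j)).trans ((mem_lqBall_iff hq hr.le).1 hθ)
    exact (Real.rpow_le_rpow_iff (abs_nonneg _) hr.le hq).1 hj
  calc ∑ j, θ j ^ 2 = ∑ j, min (θ j ^ 2) (r ^ 2) :=
        Finset.sum_congr rfl fun j _ =>
          (min_eq_left (sq_le_sq' (abs_le.1 (habs j)).1 (abs_le.1 (habs j)).2)).symm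
    _ ≤ r ^ q * (r ^ 2) ^ (1 - q / 2) := sum_min_sq_le hq hq₂ hr.le hθ (by positivity)
    _ = r ^ 2 := by
        rw [← Real.rpow_natCast r 2, ← Real.rpow_mul hr.le, ← Real.rpow_add hr]
        congr 1
        push_cast
        ring

lemma zero_mem_lqBall (hq : 0 < q) (hr : 0 ≤ r) : (0 : Fin d → ℝ) ∈ lqBall d q r := by
  rw [mem_lqBall_iff hq hr]
  simp only [Pi.zero_apply, abs_zero, Real.zero_rpow hq.ne', Finset.sum_const_zero]
  positivity

end LqBall

section Spikes

open Matrix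

variable {ι κ ν : Type*} [DecidableEq ι] [Fintype κ]

/-- The vector with entry `a` at the positions `p i` and `0` elsewhere, for injective `p`. -/
def spikes (a : ℝ) (p : κ → ι) : ι → ℝ :=
  ∑ i, Pi.single (p i) a

lemma smul_spikes (σ a : ℝ) (p : κ → ι) : σ • spikes a p = spikes (σ * a) p := by
  simp only [spikes, Finset.smul_sum, ← Pi.single_smul, smul_eq_mul]

lemma spikes_apply_self (a : ℝ) {p : κ → ι} (hp : Function.Injective p) (i : κ) :
    spikes a p (p i) = a := by
  classical
  simp [spikes, Finset.sum_apply, Pi.single_apply, hp.eq_iff]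

lemma spikes_apply_of_notMem_range (a : ℝ) {p : κ → ι} {j : ι} (hj : j ∉ Set.range p) :
    spikes a p j = 0 := by
  rw [spikes, Finset.sum_apply]
  exact Finset.sum_eq_zero fun i _ => Pi.single_eq_of_ne (fun h => hj ⟨i, h.symm⟩) _

variable [Fintype ι]

lemma sum_comp_spikes (a : ℝ) {p : κ → ι} (hp : Function.Injective p) {G : ℝ → ℝ}
    (hG : G 0 = 0) : ∑ j, G (spikes a p j) = Fintype.card κ * G a := by
  rw [← Fintype.sum_of_injective p hp (fun _ => G a) (fun j => G (spikes a p j))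
    (fun j hj => by rw [spikes_apply_of_notMem_range a hj, hG])
    fun i => by rw [spikes_apply_self a hp], Finset.sum_const, Finset.card_univ, nsmul_eq_mul]

lemma spikes_dotProduct_spikes (a : ℝ) (p p' : κ → ι) :
    spikes a p ⬝ᵥ spikes a p' = ∑ i, ∑ i', if p i = p' i' then a ^ 2 else 0 := by
  rw [Finset.sum_comm]
  simp only [spikes, sum_dotProduct, dotProduct_sum, single_dotProduct, Pi.single_apply, mul_ite,
    mul_zero, ← sq]

lemma exp_blockSpikes_dotProduct [DecidableEq ν] (a : ℝ) (e : κ × ν ↪ ι) (ω ω' : κ → ν) :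
    Real.exp (spikes a (fun i => e (i, ω i)) ⬝ᵥ spikes a (fun i => e (i, ω' i)))
      = ∏ i, if ω i = ω' i then Real.exp (a ^ 2) else 1 := by
  rw [spikes_dotProduct_spikes, Real.exp_sum]
  refine Finset.prod_congr rfl fun i _ => ?_
  rw [Finset.sum_eq_single i (fun i' _ hi' => by simp [hi'.symm]) (by simp)]
  by_cases h : ω i = ω' i <;> simp [h]

lemma sum_exp_blockSpikes_dotProduct [Fintype ν] [DecidableEq κ] (a : ℝ) (e : κ × ν ↪ ι) :
    ∑ ω : κ → ν, ∑ ω' : κ → ν,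
        Real.exp (spikes a (fun i => e (i, ω i)) ⬝ᵥ spikes a (fun i => e (i, ω' i)))
      = (Fintype.card ν : ℝ) ^ Fintype.card κ
        * (Fintype.card ν + (Real.exp (a ^ 2) - 1)) ^ Fintype.card κ := by
  classical
  have hcoord (x : ν) : ∑ y : ν, (if x = y then Real.exp (a ^ 2) else 1)
      = Fintype.card ν + (Real.exp (a ^ 2) - 1) := by
    have hsplit (y : ν) : (if x = y then Real.exp (a ^ 2) else 1)
        = 1 + if x = y then Real.exp (a ^ 2) - 1 else 0 := by split_ifs <;> ring
    simp [hsplit, Finset.sum_add_distrib]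
  have hrow (ω : κ → ν) :
      ∑ ω' : κ → ν, ∏ i, (if ω i = ω' i then Real.exp (a ^ 2) else 1)
        = (Fintype.card ν + (Real.exp (a ^ 2) - 1)) ^ Fintype.card κ := by
    rw [← Fintype.prod_sum fun i (y : ν) => if ω i = y then Real.exp (a ^ 2) else 1]
    simp only [hcoord, Finset.prod_const, Finset.card_univ]
  simp only [exp_blockSpikes_dotProduct, hrow, Finset.sum_const, Finset.card_univ,
    Fintype.card_fun, nsmul_eq_mul, Nat.cast_pow]

end Spikes

section LowerBound

variable {d : ℕ}

lemma le_minimaxRisk_of_mixture {κ : Type*} [Fintype κ] [Nonempty κ] {σ : ℝ}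
    {T : (Fin d → ℝ) → ℝ} {Θ : Set (Fin d → ℝ)} (hΘ : 0 ∈ Θ) (hT : T 0 = 0)
    {t : κ → Fin d → ℝ} (ht : ∀ i, σ • t i ∈ Θ) {ρ : ℝ} (hTt : ∀ i, T (σ • t i) = ρ)
    {M : ℝ} (hM₀ : 0 ≤ M)
    (hM : ∑ i, ∑ j, Real.exp (t i ⬝ᵥ t j) ≤ M * (Fintype.card κ) ^ 2) :
    ENNReal.ofReal (ρ ^ 2 / (2 * (1 + M))) ≤ minimaxRisk σ T Θ := by
  refine le_iInf₂ fun That hThat => ?_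
  have hrisk (s : Fin d → ℝ) (hs : σ • s ∈ Θ) :
      ∫⁻ x, ENNReal.ofReal ((That (σ • x) - T (σ • s)) ^ 2) ∂(gaussianShift s)
        ≤ maxRisk σ T Θ That := by
    rw [← sqRisk_smul σ T hThat]
    exact le_iSup₂ (f := fun θ _ => sqRisk σ T That θ) _ hs
  refine le_of_forall_lintegral_gaussianShift_le t hM₀ hM (S := fun x => That (σ • x))
    (by fun_prop) ?_ fun i => hTt i ▸ hrisk _ (ht i)
  simpa [hT] using hrisk 0 (by rwa [smul_zero])

lemma exp_sub_one_le_of_le_log {u y : ℝ} (hy : 0 ≤ y) (hu : u ≤ Real.log (1 + y) / 4) :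
    Real.exp u - 1 ≤ y / 4 := by
  have hexp : Real.exp u ≤ (1 + y) ^ (1 / 4 : ℝ) := by
    rw [Real.rpow_def_of_pos (by linarith)]
    exact Real.exp_le_exp.2 (by linarith)
  have hbernoulli := rpow_one_add_le_one_add_mul_self (s := y) (by linarith)
    (p := 1 / 4) (by norm_num) (by norm_num)
  linarith

lemma add_pow_le_two_mul_pow {n x : ℝ} {k : ℕ} (hk : 1 ≤ k) (hn : 0 ≤ n) (hx : 0 ≤ x)
    (hxn : x ≤ n / (2 * k)) : (n + x) ^ k ≤ 2 * n ^ k := by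
  have : (0 : ℝ) < k := by exact_mod_cast hk
  have hexp : Real.exp (1 / 2) ≤ 2 := by
    have h := Real.exp_bound_div_one_sub_of_interval (x := 1 / 2) (by norm_num) (by norm_num)
    norm_num at h ⊢
    exact h
  have hle : n + x ≤ n * Real.exp (1 / (2 * k)) :=
    calc n + x ≤ n * (1 / (2 * k) + 1) := by rw [mul_add, mul_one_div]; linarith
      _ ≤ n * Real.exp (1 / (2 * k)) := by gcongr; exact Real.add_one_le_exp _
  calc (n + x) ^ k ≤ (n * Real.exp (1 / (2 * k))) ^ k := by gcongr
    _ = Real.exp (1 / 2) * n ^ k := by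
        rw [mul_pow, ← Real.exp_nat_mul, mul_comm]
        congr 2
        field_simp
    _ ≤ 2 * n ^ k := by gcongr

lemma card_add_exp_pow_le {k : ℕ} (hk : 1 ≤ k) (hkd : k ^ 2 ≤ d) {u : ℝ} (hu₀ : 0 ≤ u)
    (hu : u ≤ Real.log (1 + d / (k : ℝ) ^ 2) / 4) :
    ((d / k : ℕ) + (Real.exp u - 1)) ^ k ≤ 2 * ((d / k : ℕ) : ℝ) ^ k := by
  have hk₀ : (0 : ℝ) < k := by exact_mod_cast hk
  have hd : (d : ℝ) ≤ 2 * k * (d / k : ℕ) := by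
    have hkn : k ≤ d / k := (Nat.le_div_iff_mul_le hk).2 (by rwa [← sq])
    have hmod := Nat.div_add_mod d k
    have hlt := Nat.mod_lt d hk
    exact_mod_cast (show d ≤ 2 * k * (d / k) by nlinarith)
  refine add_pow_le_two_mul_pow hk (Nat.cast_nonneg _) (by linarith [Real.add_one_le_exp u]) ?_
  refine (exp_sub_one_le_of_le_log (by positivity) hu).trans ?_
  rw [div_div, div_le_div_iff₀ (by positivity) (by positivity)]
  nlinarith [mul_le_mul_of_nonneg_left hd hk₀.le]

lemma spikes_mem_lqBall {κ : Type*} [Fintype κ] [Nonempty κ] {q r b : ℝ} (hq : 0 < q)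
    (hr : 0 ≤ r) (hbr : b ^ 2 ≤ r ^ 2 * (Fintype.card κ : ℝ) ^ (-2 / q)) {p : κ → Fin d}
    (hp : Function.Injective p) : spikes b p ∈ lqBall d q r := by
  rw [mem_lqBall_iff hq hr, sum_comp_spikes b hp (G := fun x => |x| ^ q)
    (by simp [Real.zero_rpow hq.ne']), abs_rpow_eq_sq_rpow_half]
  exact (le_sq_mul_rpow_iff hq hr (by exact_mod_cast Fintype.card_pos) (sq_nonneg b)).1 hbr

lemma l2Norm_spikes {κ : Type*} [Fintype κ] (b : ℝ) {p : κ → Fin d}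
    (hp : Function.Injective p) : l2Norm (spikes b p) = √(Fintype.card κ * b ^ 2) := by
  rw [l2Norm, sum_comp_spikes b hp (G := fun x => x ^ 2) (by simp)]

theorem le_minimaxRisk_of_spikes {k : ℕ} {q r σ a : ℝ} (hq : 0 < q) (hr : 0 ≤ r)
    (hk : 1 ≤ k) (hkd : k ^ 2 ≤ d) (ha : a ^ 2 ≤ Real.log (1 + d / (k : ℝ) ^ 2) / 4)
    (har : (σ * a) ^ 2 ≤ r ^ 2 * (k : ℝ) ^ (-2 / q)) :
    ENNReal.ofReal (k * (σ * a) ^ 2 / 6) ≤ minimaxRisk σ l2Norm (lqBall d q r) := by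
  have : NeZero k := ⟨by lia⟩
  have : NeZero (d / k) := ⟨(Nat.div_pos (by nlinarith) hk).ne'⟩
  obtain ⟨e⟩ : Nonempty (Fin k × Fin (d / k) ↪ Fin d) := by
    apply Function.Embedding.nonempty_of_card_le
    simpa only [Fintype.card_prod, Fintype.card_fin] using Nat.mul_div_le d k
  have hinj (ω : Fin k → Fin (d / k)) : Function.Injective fun i => e (i, ω i) :=
    fun i i' h => (Prod.mk.inj (e.injective h)).1
  have hmixture := le_minimaxRisk_of_mixture (σ := σ) (T := l2Norm) (Θ := lqBall d q r) (M := 2)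
    (t := fun ω : Fin k → Fin (d / k) => spikes a fun i => e (i, ω i))
    (ρ := √(k * (σ * a) ^ 2)) (zero_mem_lqBall hq hr) (by simp [l2Norm])
    (fun ω => by
      rw [smul_spikes]
      exact spikes_mem_lqBall hq hr (by rwa [Fintype.card_fin]) (hinj ω))
    (fun ω => by rw [smul_spikes, l2Norm_spikes _ (hinj ω), Fintype.card_fin]) zero_le_two ?_
  · rw [Real.sq_sqrt (by positivity)] at hmixture
    norm_num at hmixture ⊢
    exact hmixture
  · rw [sum_exp_blockSpikes_dotProduct]
    simp only [Fintype.card_fun, Fintype.card_fin, Nat.cast_pow]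
    nlinarith [mul_le_mul_of_nonneg_left (card_add_exp_pow_le hk hkd (sq_nonneg a) ha)
      (pow_nonneg (Nat.cast_nonneg (α := ℝ) (d / k)) k)]

end LowerBound

section GaussianMoments

lemma integrable_gaussianReal_of_abs_le {t C : ℝ} {g : ℝ → ℝ} (hg : Measurable g)
    (h : ∀ x, |g x| ≤ C * (1 + x ^ 4)) : Integrable g (gaussianReal t 1) := by
  have h4 : Integrable (fun x : ℝ => x ^ 4) (gaussianReal t 1) := by
    simpa [Even.pow_abs (show Even 4 by decide)] using
      (memLp_id_gaussianReal (μ := t) (v := 1) 4).integrable_norm_pow (p := 4) (by norm_num)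
  exact (((integrable_const 1).add h4).const_mul C).mono' hg.aestronglyMeasurable
    (ae_of_all _ h)

lemma memLp_two_gaussianReal_of_abs_le {t C : ℝ} {g : ℝ → ℝ} (hg : Measurable g)
    (h : ∀ x, |g x| ≤ C * (1 + x ^ 2)) : MemLp g 2 (gaussianReal t 1) := by
  rw [memLp_two_iff_integrable_sq hg.aestronglyMeasurable]
  refine integrable_gaussianReal_of_abs_le (C := 2 * C ^ 2) (hg.pow_const 2) fun x => ?_
  rw [abs_of_nonneg (sq_nonneg _), ← sq_abs]
  calc |g x| ^ 2 ≤ (C * (1 + x ^ 2)) ^ 2 := by gcongr; exact h x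
    _ ≤ 2 * C ^ 2 * (1 + x ^ 4) := by nlinarith [mul_nonneg (sq_nonneg C) (sq_nonneg (1 - x ^ 2))]

lemma integrable_sq_gaussianReal (t : ℝ) : Integrable (fun x : ℝ => x ^ 2) (gaussianReal t 1) :=
  (memLp_id_gaussianReal 2).integrable_sq

lemma integral_gaussianReal_eq_integral_add (t : ℝ) (f : ℝ → ℝ) :
    ∫ x, f x ∂gaussianReal t 1 = ∫ x, f (x + t) ∂gaussianReal 0 1 := by
  have h : gaussianReal t 1 = (gaussianReal 0 1).map (· + t) := by
    rw [gaussianReal_map_add_const, zero_add]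
  rw [h]
  exact (MeasurableEquiv.addRight t).measurableEmbedding.integral_map f

lemma integrable_pow_mul_exp_neg_half_sq (n : ℕ) :
    Integrable fun x : ℝ => x ^ n * Real.exp (-(x ^ 2 / 2)) := by
  have h := integrable_rpow_mul_exp_neg_mul_sq (b := 1 / 2) (by norm_num) (s := n)
    (by linarith [n.cast_nonneg (α := ℝ)])
  simpa [Real.rpow_natCast, div_eq_inv_mul] using h

lemma integral_gaussianReal_eq_integral_exp (f : ℝ → ℝ) :
    ∫ x, f x ∂gaussianReal 0 1
      = (√(2 * Real.pi))⁻¹ * ∫ x, f x * Real.exp (-(x ^ 2 / 2)) := by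
  rw [integral_gaussianReal_eq_integral_smul one_ne_zero, ← integral_const_mul]
  refine integral_congr_ae (ae_of_all _ fun x => ?_)
  simp only [gaussianPDFReal, NNReal.coe_one, mul_one, sub_zero, smul_eq_mul, neg_div]
  ring

lemma integral_pow_add_two_gaussianReal (n : ℕ) :
    ∫ x, x ^ (n + 2) ∂gaussianReal 0 1 = (n + 1) * ∫ x, x ^ n ∂gaussianReal 0 1 := by
  have hderiv (x : ℝ) : HasDerivAt (fun y : ℝ => y ^ (n + 1) * Real.exp (-(y ^ 2 / 2)))
      ((n + 1) * (x ^ n * Real.exp (-(x ^ 2 / 2))) - x ^ (n + 2) * Real.exp (-(x ^ 2 / 2))) x := by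
    refine ((hasDerivAt_pow (n + 1) x).mul
      (((hasDerivAt_pow 2 x).div_const 2).neg.exp)).congr_deriv ?_
    simp only [Nat.cast_add, Nat.cast_one, Nat.cast_ofNat, Nat.add_one_sub_one, Pi.neg_apply]
    ring
  have hn := (integrable_pow_mul_exp_neg_half_sq n).const_mul (n + 1 : ℝ)
  have hn₂ := integrable_pow_mul_exp_neg_half_sq (n + 2)
  have h := integral_eq_zero_of_hasDerivAt_of_integrable hderiv (hn.sub hn₂)
    (integrable_pow_mul_exp_neg_half_sq (n + 1))
  rw [integral_sub hn hn₂, integral_const_mul, sub_eq_zero] at h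
  rw [integral_gaussianReal_eq_integral_exp, integral_gaussianReal_eq_integral_exp, ← h]
  ring

lemma integral_pow_four_gaussianReal : ∫ x, x ^ 4 ∂gaussianReal 0 1 = 3 := by
  rw [integral_pow_add_two_gaussianReal 2, integral_pow_add_two_gaussianReal 0]
  norm_num

lemma integral_sq_gaussianReal (t : ℝ) : ∫ x, x ^ 2 ∂gaussianReal t 1 = t ^ 2 + 1 := by
  have h := variance_eq_sub (memLp_id_gaussianReal (μ := t) (v := 1) 2)
  simp only [variance_id_gaussianReal, NNReal.coe_one, Pi.pow_apply, id, integral_id_gaussianReal]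
    at h
  linarith

lemma integral_sq_sub_sq_gaussianReal_le (t : ℝ) :
    ∫ x, (x ^ 2 - t ^ 2) ^ 2 ∂gaussianReal t 1 ≤ 6 + 8 * t ^ 2 := by
  have h4 : Integrable (fun x : ℝ => 2 * x ^ 4) (gaussianReal 0 1) :=
    integrable_gaussianReal_of_abs_le (C := 2) (by fun_prop) fun x => by
      rw [abs_of_nonneg (by positivity)]; linarith
  have h2 := (integrable_sq_gaussianReal 0).const_mul (8 * t ^ 2)
  calc ∫ x, (x ^ 2 - t ^ 2) ^ 2 ∂gaussianReal t 1
      = ∫ x, ((x + t) ^ 2 - t ^ 2) ^ 2 ∂gaussianReal 0 1 :=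
        integral_gaussianReal_eq_integral_add t fun x => (x ^ 2 - t ^ 2) ^ 2
    _ ≤ ∫ x, (2 * x ^ 4 + 8 * t ^ 2 * x ^ 2) ∂gaussianReal 0 1 :=
        integral_mono_of_nonneg (ae_of_all _ fun x => sq_nonneg _) (h4.add h2)
          (ae_of_all _ fun x => by nlinarith [sq_nonneg (x ^ 2 - 2 * t * x)])
    _ = 6 + 8 * t ^ 2 := by
        rw [integral_add h4 h2, integral_const_mul, integral_const_mul,
          integral_sq_gaussianReal, integral_pow_four_gaussianReal]
        ring

lemma integral_exp_mul_gaussianReal (t s : ℝ) :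
    ∫ x, Real.exp (s * x) ∂gaussianReal t 1 = Real.exp (t * s + s ^ 2 / 2) := by
  simpa [mgf] using congrFun (mgf_fun_id_gaussianReal (μ := t) (v := 1)) s

end GaussianMoments

section EvenFunctions

/-- The density of `(N(t, 1) + N(-t, 1)) / 2` with respect to `N(0, 1)`. It is used to integrate
even functions, for which `N(t, 1)` and `N(-t, 1)` give the same value. -/
noncomputable def symmDensity (t x : ℝ) : ℝ := Real.exp (-(t ^ 2 / 2)) * Real.cosh (t * x)

lemma abs_symmDensity_sub_one_le (t x : ℝ) :
    |symmDensity t x - 1| ≤ t ^ 2 / 2 * ((symmDensity t x + 1) * (x ^ 2 + 1)) := by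
  have hexp (u : ℝ) : 1 - u ≤ Real.exp (-u) := Real.one_sub_le_exp_neg u
  have hcosh (z : ℝ) : Real.cosh z * (1 - z ^ 2 / 2) ≤ 1 :=
    calc Real.cosh z * (1 - z ^ 2 / 2)
        ≤ Real.cosh z * Real.exp (-(z ^ 2 / 2)) := by
          gcongr
          exact hexp _
      _ ≤ Real.exp (z ^ 2 / 2) * Real.exp (-(z ^ 2 / 2)) := by
          gcongr; exact Real.cosh_le_exp_half_sq z
      _ = 1 := by rw [← Real.exp_add, add_neg_cancel, Real.exp_zero]
  have hw : 0 ≤ symmDensity t x := mul_nonneg (Real.exp_pos _).le (Real.cosh_pos _).le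
  have hexp_le : Real.exp (-(t ^ 2 / 2)) ≤ 1 := Real.exp_le_one_iff.2 (by nlinarith [sq_nonneg t])
  have hlower : 1 - t ^ 2 / 2 ≤ symmDensity t x :=
    (hexp _).trans (le_mul_of_one_le_right (Real.exp_pos _).le (Real.one_le_cosh _))
  have hupper : symmDensity t x * (1 - (t * x) ^ 2 / 2) ≤ 1 := by
    rw [symmDensity, mul_assoc]
    nlinarith [hcosh (t * x), Real.exp_pos (-(t ^ 2 / 2))]
  have := mul_nonneg (sq_nonneg t) hw
  have := mul_nonneg (sq_nonneg t) (sq_nonneg x)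
  have := mul_nonneg (mul_nonneg (sq_nonneg t) hw) (sq_nonneg x)
  rw [abs_le]
  constructor <;> nlinarith [sq_nonneg t]

lemma integrable_exp_mul_of_integrable_gaussianReal {t : ℝ} {f : ℝ → ℝ}
    (hf : Integrable f (gaussianReal t 1)) :
    Integrable (fun x => Real.exp (t * x - t * t / 2) * f x) (gaussianReal 0 1) := by
  rw [gaussianReal_eq_withDensity, integrable_withDensity_iff_integrable_smul' (by fun_prop)
    (ae_of_all _ fun _ => ENNReal.ofReal_lt_top)] at hf
  simpa [ENNReal.toReal_ofReal (Real.exp_pos _).le] using hf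

lemma integral_exp_mul_eq_integral_gaussianReal (t : ℝ) (f : ℝ → ℝ) :
    ∫ x, Real.exp (t * x - t * t / 2) * f x ∂gaussianReal 0 1 = ∫ x, f x ∂gaussianReal t 1 := by
  rw [gaussianReal_eq_withDensity t, integral_withDensity_eq_integral_toReal_smul (by fun_prop)
    (ae_of_all _ fun _ => ENNReal.ofReal_lt_top)]
  simp [ENNReal.toReal_ofReal (Real.exp_pos _).le]

variable {t : ℝ} {f : ℝ → ℝ}

lemma symmDensity_mul_eq (t : ℝ) (f : ℝ → ℝ) (x : ℝ) :
    symmDensity t x * f x = (Real.exp (t * x - t * t / 2) * f x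
      + Real.exp (-t * x - -t * -t / 2) * f x) / 2 := by
  rw [symmDensity, Real.cosh_eq, sub_eq_add_neg, sub_eq_add_neg, Real.exp_add, Real.exp_add]
  ring_nf

lemma integrable_gaussianReal_neg (hf : Function.Even f) (hint : Integrable f (gaussianReal t 1)) :
    Integrable f (gaussianReal (-t) 1) := by
  rw [← gaussianReal_map_neg]
  refine ((MeasurableEquiv.neg ℝ).measurableEmbedding.integrable_map_iff).2 ?_
  exact hint.congr (ae_of_all _ fun x => (hf x).symm)

lemma integral_gaussianReal_neg (hf : Function.Even f) :
    ∫ x, f x ∂gaussianReal (-t) 1 = ∫ x, f x ∂gaussianReal t 1 := by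
  rw [← gaussianReal_map_neg]
  refine ((MeasurableEquiv.neg ℝ).measurableEmbedding.integral_map f).trans ?_
  exact integral_congr_ae (ae_of_all _ hf)

lemma integrable_symmDensity_mul (hf : Function.Even f)
    (hint : Integrable f (gaussianReal t 1)) :
    Integrable (fun x => symmDensity t x * f x) (gaussianReal 0 1) := by
  simp_rw [symmDensity_mul_eq]
  exact ((integrable_exp_mul_of_integrable_gaussianReal hint).add
    (integrable_exp_mul_of_integrable_gaussianReal (integrable_gaussianReal_neg hf hint))).div_const
    2

lemma integral_symmDensity_mul (hf : Function.Even f) (hint : Integrable f (gaussianReal t 1)) :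
    ∫ x, symmDensity t x * f x ∂gaussianReal 0 1 = ∫ x, f x ∂gaussianReal t 1 := by
  simp_rw [symmDensity_mul_eq]
  rw [integral_div, integral_add (integrable_exp_mul_of_integrable_gaussianReal hint)
    (integrable_exp_mul_of_integrable_gaussianReal (integrable_gaussianReal_neg hf hint)),
    integral_exp_mul_eq_integral_gaussianReal, integral_exp_mul_eq_integral_gaussianReal,
    integral_gaussianReal_neg hf, add_self_div_two]

theorem abs_integral_gaussianReal_sub_le (hf : Function.Even f) (hfm : Measurable f)
    (ht : Integrable (fun x => |f x| * (x ^ 2 + 1)) (gaussianReal t 1))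
    (h0 : Integrable (fun x => |f x| * (x ^ 2 + 1)) (gaussianReal 0 1)) :
    |∫ x, f x ∂gaussianReal t 1 - ∫ x, f x ∂gaussianReal 0 1|
      ≤ t ^ 2 / 2 * (∫ x, |f x| * (x ^ 2 + 1) ∂gaussianReal t 1
        + ∫ x, |f x| * (x ^ 2 + 1) ∂gaussianReal 0 1) := by
  have hint {s : ℝ} (hs : Integrable (fun x => |f x| * (x ^ 2 + 1)) (gaussianReal s 1)) :
      Integrable f (gaussianReal s 1) :=
    hs.mono' hfm.aestronglyMeasurable <| ae_of_all _ fun x =>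
      le_mul_of_one_le_right (abs_nonneg _) (by nlinarith [sq_nonneg x])
  have hG : Function.Even fun x => |f x| * (x ^ 2 + 1) := fun x => by simp only [hf x, neg_sq]
  have hGw := integrable_symmDensity_mul hG ht
  calc |∫ x, f x ∂gaussianReal t 1 - ∫ x, f x ∂gaussianReal 0 1|
      = |∫ x, (symmDensity t x * f x - f x) ∂gaussianReal 0 1| := by
        rw [integral_sub (integrable_symmDensity_mul hf (hint ht)) (hint h0),
          integral_symmDensity_mul hf (hint ht)]
    _ ≤ ∫ x, |symmDensity t x * f x - f x| ∂gaussianReal 0 1 := abs_integral_le_integral_abs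
    _ ≤ ∫ x, t ^ 2 / 2 * (symmDensity t x * (|f x| * (x ^ 2 + 1)) + |f x| * (x ^ 2 + 1))
          ∂gaussianReal 0 1 := by
        refine integral_mono ((integrable_symmDensity_mul hf (hint ht)).sub (hint h0)).abs
          ((hGw.add h0).const_mul _) fun x => ?_
        calc |symmDensity t x * f x - f x| = |symmDensity t x - 1| * |f x| := by
              rw [← abs_mul, sub_one_mul]
          _ ≤ t ^ 2 / 2 * ((symmDensity t x + 1) * (x ^ 2 + 1)) * |f x| := by
              gcongr; exact abs_symmDensity_sub_one_le t x
          _ = _ := by ring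
    _ = _ := by rw [integral_const_mul, integral_add hGw h0, integral_symmDensity_mul hG ht]

end EvenFunctions

section GaussianTails

lemma setIntegral_Ioi_mul_exp_neg_half_sq_eq_zero (τ : ℝ) :
    ∫ y in Set.Ioi τ, (y ^ 2 - τ * y - 1) * Real.exp (-(y ^ 2 / 2)) = 0 := by
  have hderiv (x : ℝ) : HasDerivAt (fun y => (τ - y) * Real.exp (-(y ^ 2 / 2)))
      ((x ^ 2 - τ * x - 1) * Real.exp (-(x ^ 2 / 2))) x := by
    refine (((hasDerivAt_id x).const_sub τ).mul
      (((hasDerivAt_pow 2 x).div_const 2).neg.exp)).congr_deriv ?_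
    simp only [id, Nat.cast_ofNat, Nat.add_one_sub_one, Pi.neg_apply]
    ring
  have h0 := integrable_pow_mul_exp_neg_half_sq 0
  have h1 := integrable_pow_mul_exp_neg_half_sq 1
  have h2 := integrable_pow_mul_exp_neg_half_sq 2
  have hf : Integrable fun y : ℝ => (τ - y) * Real.exp (-(y ^ 2 / 2)) :=
    ((h0.const_mul τ).sub h1).congr (ae_of_all _ fun y => by simp; ring)
  have hf' : Integrable fun y : ℝ => (y ^ 2 - τ * y - 1) * Real.exp (-(y ^ 2 / 2)) :=
    ((h2.sub (h1.const_mul τ)).sub h0).congr (ae_of_all _ fun y => by simp; ring)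
  rw [integral_Ioi_of_hasDerivAt_of_tendsto' (fun x _ => hderiv x) hf'.integrableOn
    (tendsto_zero_of_hasDerivAt_of_integrableOn_Ioi (a := τ) (fun x _ => hderiv x)
      hf'.integrableOn hf.integrableOn)]
  ring

lemma measurableSet_lt_abs (τ : ℝ) : MeasurableSet {x : ℝ | τ < |x|} :=
  measurableSet_lt measurable_const measurable_abs

lemma setIntegral_lt_abs_gaussianReal {τ : ℝ} (hτ : 0 ≤ τ) (f : ℝ → ℝ) :
    ∫ x in {x | τ < |x|}, f |x| ∂gaussianReal 0 1
      = (√(2 * Real.pi))⁻¹ * (2 * ∫ y in Set.Ioi τ, f y * Real.exp (-(y ^ 2 / 2))) := by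
  have habs (x : ℝ) : {x : ℝ | τ < |x|}.indicator (fun x => f |x|) x * Real.exp (-(x ^ 2 / 2))
      = (Set.Ioi τ).indicator (fun y => f y * Real.exp (-(y ^ 2 / 2))) |x| := by
    by_cases hx : τ < |x| <;> simp [Set.indicator, hx]
  rw [← integral_indicator (measurableSet_lt_abs τ), integral_gaussianReal_eq_integral_exp]
  simp_rw [habs]
  rw [integral_comp_abs, setIntegral_indicator measurableSet_Ioi, Set.Ioi_inter_Ioi,
    sup_of_le_right hτ]

/-- The second moment of a standard normal variable conditioned to exceed `τ` in absolute value. -/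
noncomputable def tailMoment (τ : ℝ) : ℝ :=
  ∫ x, x ^ 2 ∂ProbabilityTheory.cond (gaussianReal 0 1) {x | τ < |x|}

lemma gaussianReal_real_lt_abs_pos (τ : ℝ) : 0 < (gaussianReal 0 1).real {x | τ < |x|} := by
  refine ENNReal.toReal_pos (fun h0 => ?_) (measure_ne_top _ _)
  have hIoi : volume (Set.Ioi τ) = 0 :=
    measure_mono_null (fun x (hx : τ < x) => hx.trans_le (le_abs_self x))
      (gaussianReal_absolutelyContinuous' 0 one_ne_zero h0)
  simp at hIoi

lemma setIntegral_sq_lt_abs_gaussianReal (τ : ℝ) :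
    ∫ x in {x | τ < |x|}, x ^ 2 ∂gaussianReal 0 1
      = tailMoment τ * (gaussianReal 0 1).real {x | τ < |x|} := by
  have h := gaussianReal_real_lt_abs_pos τ
  rw [tailMoment, ProbabilityTheory.cond, integral_smul_measure, ENNReal.toReal_inv, smul_eq_mul,
    ← measureReal_def]
  field_simp

lemma setIntegral_sq_sub_lt_abs_gaussianReal (τ α : ℝ) :
    ∫ x in {x | τ < |x|}, (x ^ 2 - α) ∂gaussianReal 0 1
      = (tailMoment τ - α) * (gaussianReal 0 1).real {x | τ < |x|} := by
  rw [integral_sub (integrable_sq_gaussianReal 0).integrableOn (integrable_const _),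
    setIntegral_sq_lt_abs_gaussianReal, sub_mul, setIntegral_const, smul_eq_mul, mul_comm α]

lemma tailMoment_nonneg (τ : ℝ) : 0 ≤ tailMoment τ := integral_nonneg fun x => sq_nonneg x

lemma tailMoment_le {τ : ℝ} (hτ : 0 ≤ τ) : tailMoment τ ≤ τ ^ 2 + 2 := by
  have h0 := integrable_pow_mul_exp_neg_half_sq 0
  have h1 := integrable_pow_mul_exp_neg_half_sq 1
  have h2 := integrable_pow_mul_exp_neg_half_sq 2
  have hIoi : ∫ y in Set.Ioi τ, (y ^ 2 - (τ ^ 2 + 2)) * Real.exp (-(y ^ 2 / 2)) ≤ 0 :=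
    calc ∫ y in Set.Ioi τ, (y ^ 2 - (τ ^ 2 + 2)) * Real.exp (-(y ^ 2 / 2))
        ≤ ∫ y in Set.Ioi τ, 2 * ((y ^ 2 - τ * y - 1) * Real.exp (-(y ^ 2 / 2))) := by
          refine integral_mono (Integrable.integrableOn ?_) (Integrable.integrableOn ?_) fun y => ?_
          · exact (h2.sub (h0.const_mul (τ ^ 2 + 2))).congr (ae_of_all _ fun y => by simp; ring)
          · exact (((h2.sub (h1.const_mul τ)).sub h0).const_mul 2).congr
              (ae_of_all _ fun y => by simp; ring)
          · simp only [← mul_assoc]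
            gcongr
            nlinarith [sq_nonneg (y - τ)]
      _ = 0 := by
          rw [integral_const_mul, setIntegral_Ioi_mul_exp_neg_half_sq_eq_zero, mul_zero]
  have htail : (tailMoment τ - (τ ^ 2 + 2)) * (gaussianReal 0 1).real {x | τ < |x|} ≤ 0 := by
    rw [← setIntegral_sq_sub_lt_abs_gaussianReal]
    have h := setIntegral_lt_abs_gaussianReal hτ fun x => x ^ 2 - (τ ^ 2 + 2)
    simp only [sq_abs] at h
    rw [h]
    exact mul_nonpos_of_nonneg_of_nonpos (by positivity) (by linarith)
  nlinarith [gaussianReal_real_lt_abs_pos τ]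

/-- The function `x ^ 4` truncated to `τ < |x|`, which dominates the hard-threshold statistic. -/
noncomputable def tailFourth (τ : ℝ) : ℝ → ℝ := {x | τ < |x|}.indicator fun x => x ^ 4

lemma integrable_tailFourth (t τ : ℝ) : Integrable (tailFourth τ) (gaussianReal t 1) := by
  refine Integrable.indicator ?_ (measurableSet_lt_abs τ)
  refine integrable_gaussianReal_of_abs_le (C := 1) (by fun_prop) fun x => ?_
  rw [abs_of_nonneg (by positivity)]
  linarith

lemma integral_cosh_mul_gaussianReal (t s : ℝ) :
    ∫ x, Real.cosh (s * x) ∂gaussianReal t 1 = Real.exp (s ^ 2 / 2) * Real.cosh (s * t) := by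
  have h (c : ℝ) : Integrable (fun x => Real.exp (c * x)) (gaussianReal t 1) :=
    integrable_exp_mul_gaussianReal c
  simp_rw [Real.cosh_eq, ← neg_mul]
  rw [integral_div, integral_add (h s) (h (-s)), integral_exp_mul_gaussianReal,
    integral_exp_mul_gaussianReal, neg_sq, Real.exp_add, Real.exp_add]
  ring_nf

lemma cosh_le_exp_abs (x : ℝ) : Real.cosh x ≤ Real.exp |x| := by
  rw [← Real.cosh_abs, Real.cosh_eq]
  linarith [Real.exp_le_exp.2 (neg_le_self (abs_nonneg x))]

lemma tailFourth_le_cosh {τ : ℝ} (hτ : 2 ≤ τ) (x : ℝ) :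
    tailFourth τ x ≤ 2 * τ ^ 4 * Real.exp (-τ ^ 2) * Real.cosh (τ * x) := by
  refine Set.indicator_apply_le' (fun hx => ?_) fun _ => by positivity [Real.cosh_pos (τ * x)]
  have hτx : τ < |x| := hx
  have hle : |x| ≤ τ * Real.exp ((τ * |x| - τ ^ 2) / 4) :=
    calc |x| ≤ τ * ((τ * |x| - τ ^ 2) / 4 + 1) := by
          nlinarith [mul_nonneg (show 0 ≤ τ ^ 2 - 4 by nlinarith) (sub_nonneg.2 hτx.le)]
      _ ≤ τ * Real.exp ((τ * |x| - τ ^ 2) / 4) := by gcongr; exact Real.add_one_le_exp _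
  calc x ^ 4 = |x| ^ 4 := (Even.pow_abs (by decide) x).symm
    _ ≤ (τ * Real.exp ((τ * |x| - τ ^ 2) / 4)) ^ 4 := by gcongr
    _ = τ ^ 4 * Real.exp (-τ ^ 2) * Real.exp |τ * x| := by
        rw [mul_pow, ← Real.exp_nat_mul, mul_assoc, ← Real.exp_add, abs_mul,
          abs_of_pos (show 0 < τ by linarith)]
        congr 2; push_cast; ring
    _ ≤ τ ^ 4 * Real.exp (-τ ^ 2) * (2 * Real.cosh (τ * x)) := by
        gcongr
        linarith [Real.exp_abs_le (τ * x), Real.cosh_eq (τ * x)]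
    _ = 2 * τ ^ 4 * Real.exp (-τ ^ 2) * Real.cosh (τ * x) := by ring

lemma integral_tailFourth_le {τ : ℝ} (hτ : 2 ≤ τ) (t : ℝ) :
    ∫ x, tailFourth τ x ∂gaussianReal t 1 ≤ 2 * τ ^ 4 * Real.exp (τ * |t| - τ ^ 2 / 2) := by
  have hcosh : Integrable (fun x => Real.cosh (τ * x)) (gaussianReal t 1) := by
    simp_rw [Real.cosh_eq, ← neg_mul]
    exact ((integrable_exp_mul_gaussianReal τ).add
      (integrable_exp_mul_gaussianReal (-τ))).div_const 2
  calc ∫ x, tailFourth τ x ∂gaussianReal t 1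
      ≤ ∫ x, 2 * τ ^ 4 * Real.exp (-τ ^ 2) * Real.cosh (τ * x) ∂gaussianReal t 1 :=
        integral_mono (integrable_tailFourth t τ) (hcosh.const_mul _) (tailFourth_le_cosh hτ)
    _ ≤ 2 * τ ^ 4 * Real.exp (-τ ^ 2) * (Real.exp (τ ^ 2 / 2) * Real.exp |τ * t|) := by
        rw [integral_const_mul, integral_cosh_mul_gaussianReal]
        gcongr
        exact cosh_le_exp_abs _
    _ = 2 * τ ^ 4 * Real.exp (τ * |t| - τ ^ 2 / 2) := by
        rw [mul_assoc, ← Real.exp_add, ← Real.exp_add, abs_mul, abs_of_nonneg (by linarith)]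
        congr 2; ring

end GaussianTails

section HardThreshold

/-- The hard-threshold estimator of `t ^ 2` from one observation of `N(t, 1)`, centred so that it
is unbiased at `t = 0`. -/
noncomputable def hardStat (τ : ℝ) : ℝ → ℝ := {x | τ < |x|}.indicator fun x => x ^ 2 - tailMoment τ

lemma measurable_hardStat (τ : ℝ) : Measurable (hardStat τ) :=
  Measurable.indicator (by fun_prop) (measurableSet_lt_abs τ)

lemma even_hardStat (τ : ℝ) : Function.Even (hardStat τ) := fun x => by
  simp [hardStat, Set.indicator]

lemma integral_hardStat_gaussianReal_zero (τ : ℝ) :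
    ∫ x, hardStat τ x ∂gaussianReal 0 1 = 0 := by
  rw [hardStat, integral_indicator (measurableSet_lt_abs τ),
    setIntegral_sq_sub_lt_abs_gaussianReal, sub_self, zero_mul]

variable {τ : ℝ}

lemma abs_hardStat_le_indicator (hτ : 2 ≤ τ) (x : ℝ) :
    |hardStat τ x| ≤ {x | τ < |x|}.indicator (fun x => 2 * x ^ 2) x := by
  by_cases hx : τ < |x|
  · have hτx : τ ^ 2 ≤ x ^ 2 := by rw [← sq_abs x]; gcongr
    have hα := tailMoment_le (show 0 ≤ τ by linarith)
    rw [hardStat, Set.indicator_of_mem (by exact hx), Set.indicator_of_mem (by exact hx), abs_le]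
    constructor <;> nlinarith [tailMoment_nonneg τ]
  · simp [hardStat, hx]

lemma abs_hardStat_le (hτ : 2 ≤ τ) (x : ℝ) : |hardStat τ x| ≤ 2 * (1 + x ^ 2) :=
  (abs_hardStat_le_indicator hτ x).trans <|
    Set.indicator_apply_le' (fun _ => by linarith) fun _ => by positivity

lemma abs_hardStat_mul_le (hτ : 2 ≤ τ) (x : ℝ) :
    |hardStat τ x| * (x ^ 2 + 1) ≤ 4 * tailFourth τ x := by
  have h := abs_hardStat_le_indicator hτ x
  by_cases hx : τ < |x|
  · have hτx : τ ^ 2 ≤ x ^ 2 := by rw [← sq_abs x]; gcongr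
    simp only [tailFourth, Set.indicator, Set.mem_ofPred_eq, hx, if_true] at h ⊢
    calc |hardStat τ x| * (x ^ 2 + 1) ≤ 2 * x ^ 2 * (2 * x ^ 2) := by gcongr; nlinarith
      _ = 4 * x ^ 4 := by ring
  · simp [hardStat, tailFourth, hx]

lemma hardStat_sq_le (hτ : 2 ≤ τ) (x : ℝ) : hardStat τ x ^ 2 ≤ 4 * tailFourth τ x := by
  have h := abs_hardStat_le_indicator hτ x
  by_cases hx : τ < |x|
  · simp only [tailFourth, Set.indicator, Set.mem_ofPred_eq, hx, if_true] at h ⊢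
    calc hardStat τ x ^ 2 ≤ (2 * x ^ 2) ^ 2 := sq_le_sq' (abs_le.1 h).1 (abs_le.1 h).2
      _ = 4 * x ^ 4 := by ring
  · simp [hardStat, tailFourth, hx]

lemma abs_hardStat_sub_sq_le (hτ : 2 ≤ τ) (x : ℝ) : |hardStat τ x - x ^ 2| ≤ 2 * τ ^ 2 := by
  by_cases hx : τ < |x|
  · have hα := tailMoment_le (show 0 ≤ τ by linarith)
    rw [hardStat, Set.indicator_of_mem (by exact hx), sub_sub_cancel_left, abs_neg,
      abs_of_nonneg (tailMoment_nonneg τ)]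
    nlinarith
  · have hxτ : x ^ 2 ≤ τ ^ 2 := by rw [← sq_abs x]; gcongr; exact not_lt.1 hx
    rw [hardStat, Set.indicator_of_notMem (by exact hx), zero_sub, abs_neg,
      abs_of_nonneg (sq_nonneg x)]
    linarith [sq_nonneg τ]

lemma memLp_hardStat (hτ : 2 ≤ τ) (t : ℝ) : MemLp (hardStat τ) 2 (gaussianReal t 1) :=
  memLp_two_gaussianReal_of_abs_le (measurable_hardStat τ) (abs_hardStat_le hτ)

lemma integrable_hardStat (hτ : 2 ≤ τ) (t : ℝ) : Integrable (hardStat τ) (gaussianReal t 1) :=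
  (memLp_hardStat hτ t).integrable (by norm_num)

variable {L t : ℝ}

lemma two_le_sqrt_eight_mul (hL : 1 / 2 ≤ L) : 2 ≤ √(8 * L) :=
  Real.le_sqrt_of_sq_le (by linarith)

lemma integral_tailFourth_le_sq_mul_exp_neg (hL : 1 / 2 ≤ L) (ht : t ^ 2 ≤ L) :
    ∫ x, tailFourth √(8 * L) x ∂gaussianReal t 1 ≤ 128 * (L ^ 2 * Real.exp (-L)) := by
  have hτ : √(8 * L) ^ 2 = 8 * L := Real.sq_sqrt (by linarith)
  have hτt : √(8 * L) * |t| ≤ 3 * L := by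
    rw [← Real.sqrt_sq_eq_abs, ← Real.sqrt_mul (by linarith)]
    exact Real.sqrt_le_iff.2 ⟨by linarith, by nlinarith⟩
  calc ∫ x, tailFourth √(8 * L) x ∂gaussianReal t 1
      ≤ 2 * √(8 * L) ^ 4 * Real.exp (√(8 * L) * |t| - √(8 * L) ^ 2 / 2) :=
        integral_tailFourth_le (two_le_sqrt_eight_mul hL) t
    _ ≤ 2 * √(8 * L) ^ 4 * Real.exp (-L) := by
        gcongr
        linarith
    _ = 128 * (L ^ 2 * Real.exp (-L)) := by
        rw [show √(8 * L) ^ 4 = (√(8 * L) ^ 2) ^ 2 by ring, hτ]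
        ring

lemma integral_tailFourth_le_const (hL : 1 / 2 ≤ L) (ht : t ^ 2 ≤ L) :
    ∫ x, tailFourth √(8 * L) x ∂gaussianReal t 1 ≤ 256 := by
  have hexp : L ^ 2 * Real.exp (-L) ≤ 2 := by
    rw [Real.exp_neg, ← div_eq_mul_inv, div_le_iff₀ (Real.exp_pos L)]
    linarith [Real.quadratic_le_exp_of_nonneg (show 0 ≤ L by linarith)]
  linarith [integral_tailFourth_le_sq_mul_exp_neg hL ht]

lemma abs_integral_hardStat_le (hL : 1 / 2 ≤ L) (ht : t ^ 2 ≤ L) :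
    |∫ x, hardStat √(8 * L) x ∂gaussianReal t 1| ≤ 1024 * t ^ 2 := by
  have hτ := two_le_sqrt_eight_mul hL
  have hdom (s : ℝ) : Integrable (fun x => |hardStat √(8 * L) x| * (x ^ 2 + 1))
      (gaussianReal s 1) := by
    refine ((integrable_tailFourth s √(8 * L)).const_mul 4).mono'
      ((measurable_hardStat _).abs.mul (by fun_prop)).aestronglyMeasurable (ae_of_all _ fun x => ?_)
    rw [Real.norm_of_nonneg (by positivity)]
    exact abs_hardStat_mul_le hτ x
  have hbound {s : ℝ} (hs : s ^ 2 ≤ L) :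
      ∫ x, |hardStat √(8 * L) x| * (x ^ 2 + 1) ∂gaussianReal s 1 ≤ 1024 :=
    calc ∫ x, |hardStat √(8 * L) x| * (x ^ 2 + 1) ∂gaussianReal s 1
        ≤ ∫ x, 4 * tailFourth √(8 * L) x ∂gaussianReal s 1 :=
          integral_mono (hdom s) ((integrable_tailFourth s _).const_mul 4) (abs_hardStat_mul_le hτ)
      _ ≤ 1024 := by
          rw [integral_const_mul 4]
          linarith [integral_tailFourth_le_const hL hs]
  have h := abs_integral_gaussianReal_sub_le (even_hardStat √(8 * L)) (measurable_hardStat _)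
    (hdom t) (hdom 0)
  rw [integral_hardStat_gaussianReal_zero, sub_zero] at h
  nlinarith [hbound ht, hbound (s := 0) (by linarith [sq_nonneg t]), sq_nonneg t]

lemma abs_integral_hardStat_sub_sq_le (hL : 1 / 2 ≤ L) (t : ℝ) :
    |∫ x, hardStat √(8 * L) x ∂gaussianReal t 1 - t ^ 2| ≤ 1025 * min (t ^ 2) L := by
  rcases le_total (t ^ 2) L with ht | ht
  · rw [min_eq_left ht]
    have h := abs_sub (∫ x, hardStat √(8 * L) x ∂gaussianReal t 1) (t ^ 2)
    rw [abs_of_nonneg (sq_nonneg t)] at h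
    linarith [abs_integral_hardStat_le hL ht]
  · rw [min_eq_right ht]
    have hτ := two_le_sqrt_eight_mul hL
    have hpoint (x : ℝ) : ‖hardStat √(8 * L) x - x ^ 2‖ ≤ 16 * L := by
      have h := abs_hardStat_sub_sq_le hτ x
      rw [Real.sq_sqrt (by linarith)] at h
      exact h.trans (by linarith)
    have hsub : |∫ x, (hardStat √(8 * L) x - x ^ 2) ∂gaussianReal t 1| ≤ 16 * L := by
      simpa using norm_integral_le_of_norm_le_const (μ := gaussianReal t 1) (ae_of_all _ hpoint)
    rw [integral_sub (integrable_hardStat hτ t) (integrable_sq_gaussianReal t),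
      integral_sq_gaussianReal] at hsub
    rw [abs_le] at hsub ⊢
    constructor <;> linarith

lemma variance_le_integral_sub_sq {Ω : Type*} [MeasurableSpace Ω] {μ : Measure Ω}
    [IsProbabilityMeasure μ] {X : Ω → ℝ} (hX : AEStronglyMeasurable X μ) (c : ℝ) :
    Var[X; μ] ≤ ∫ ω, (X ω - c) ^ 2 ∂μ := by
  rw [← variance_sub_const hX c]
  exact variance_le_expectation_sq (hX.sub aestronglyMeasurable_const)

lemma integral_hardStat_sub_sq_sq_le (hL : 1 / 2 ≤ L) (t : ℝ) :
    ∫ x, (hardStat √(8 * L) x - t ^ 2) ^ 2 ∂gaussianReal t 1 ≤ 512 * L ^ 2 + 12 + 16 * t ^ 2 := by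
  have hint : Integrable (fun x : ℝ => 2 * (x ^ 2 - t ^ 2) ^ 2) (gaussianReal t 1) :=
    ((memLp_two_gaussianReal_of_abs_le (C := 1 + t ^ 2) (g := fun x => x ^ 2 - t ^ 2) (by fun_prop)
      fun x => abs_le.2 ⟨by nlinarith [sq_nonneg (t * x), sq_nonneg x],
        by nlinarith [sq_nonneg (t * x), sq_nonneg t]⟩).integrable_sq).const_mul 2
  calc ∫ x, (hardStat √(8 * L) x - t ^ 2) ^ 2 ∂gaussianReal t 1
      ≤ ∫ x, (512 * L ^ 2 + 2 * (x ^ 2 - t ^ 2) ^ 2) ∂gaussianReal t 1 := by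
        refine integral_mono_of_nonneg (ae_of_all _ fun x => sq_nonneg _)
          ((integrable_const _).add hint) (ae_of_all _ fun x => ?_)
        have h := abs_hardStat_sub_sq_le (two_le_sqrt_eight_mul hL) x
        rw [Real.sq_sqrt (by linarith)] at h
        have hsq : (hardStat √(8 * L) x - x ^ 2) ^ 2 ≤ (2 * (8 * L)) ^ 2 :=
          sq_le_sq' (abs_le.1 h).1 (abs_le.1 h).2
        simp only
        nlinarith [sq_nonneg ((hardStat √(8 * L) x - x ^ 2) - (x ^ 2 - t ^ 2))]
    _ ≤ 512 * L ^ 2 + 12 + 16 * t ^ 2 := by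
        rw [integral_add (integrable_const _) hint, integral_const_mul 2, integral_const,
          probReal_univ, one_smul]
        linarith [integral_sq_sub_sq_gaussianReal_le t]

lemma variance_hardStat_le (hL : 1 / 2 ≤ L) (t : ℝ) :
    Var[hardStat √(8 * L); gaussianReal t 1]
      ≤ 512 * (L ^ 2 * Real.exp (-L)) + 592 * (L * t ^ 2) := by
  have hvar := variance_le_integral_sub_sq (μ := gaussianReal t 1)
    (measurable_hardStat √(8 * L)).aestronglyMeasurable
  rcases le_total (t ^ 2) L with ht | ht
  · calc Var[hardStat √(8 * L); gaussianReal t 1]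
        ≤ ∫ x, (hardStat √(8 * L) x - 0) ^ 2 ∂gaussianReal t 1 := hvar 0
      _ ≤ ∫ x, 4 * tailFourth √(8 * L) x ∂gaussianReal t 1 := by
          refine integral_mono_of_nonneg (ae_of_all _ fun x => sq_nonneg _)
            ((integrable_tailFourth t _).const_mul 4) (ae_of_all _ fun x => ?_)
          simpa only [sub_zero] using hardStat_sq_le (two_le_sqrt_eight_mul hL) x
      _ ≤ 512 * (L ^ 2 * Real.exp (-L)) := by
          rw [integral_const_mul]
          linarith [integral_tailFourth_le_sq_mul_exp_neg hL ht]
      _ ≤ 512 * (L ^ 2 * Real.exp (-L)) + 592 * (L * t ^ 2) :=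
          le_add_of_nonneg_right (by positivity)
  · calc Var[hardStat √(8 * L); gaussianReal t 1]
        ≤ ∫ x, (hardStat √(8 * L) x - t ^ 2) ^ 2 ∂gaussianReal t 1 := hvar (t ^ 2)
      _ ≤ 512 * L ^ 2 + 12 + 16 * t ^ 2 := integral_hardStat_sub_sq_sq_le hL t
      _ ≤ 592 * (L * t ^ 2) := by nlinarith
      _ ≤ 512 * (L ^ 2 * Real.exp (-L)) + 592 * (L * t ^ 2) :=
          le_add_of_nonneg_left (by positivity)

end HardThreshold

section SquareRoot

lemma mul_sqrt_posPart_sub_sq_le {A T : ℝ} (hA : 0 ≤ A) (hT : 0 ≤ T) (Z : ℝ) :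
    (A + T ^ 2) * (√(max Z 0) - T) ^ 2 ≤ 1 / 2 * A ^ 2 + 3 / 2 * (Z - T ^ 2) ^ 2 := by
  set w := √(max Z 0) with hw
  have hw₀ : 0 ≤ w := Real.sqrt_nonneg _
  have hdist : |w ^ 2 - T ^ 2| ≤ |Z - T ^ 2| := by
    rw [hw, Real.sq_sqrt (le_max_right _ _)]
    have hmax : max (T ^ 2) 0 = T ^ 2 := max_eq_left (sq_nonneg T)
    exact (congrArg (|max Z 0 - ·|) hmax.symm).trans_le (abs_max_sub_max_le_abs Z (T ^ 2) 0)
  have hfactor : |w - T| * (w + T) ≤ |Z - T ^ 2| := by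
    rwa [← abs_of_nonneg (add_nonneg hw₀ hT), ← abs_mul,
      show (w - T) * (w + T) = w ^ 2 - T ^ 2 by ring]
  have habs : |w - T| ≤ w + T := abs_le.2 ⟨by linarith, by linarith⟩
  have hsmall : (w - T) ^ 2 ≤ |Z - T ^ 2| := by
    rw [← sq_abs, sq]
    exact (mul_le_mul_of_nonneg_left habs (abs_nonneg _)).trans hfactor
  have hlarge : T ^ 2 * (w - T) ^ 2 ≤ (Z - T ^ 2) ^ 2 := by
    rw [← sq_abs (w - T), ← sq_abs (Z - T ^ 2), ← mul_pow, mul_comm T]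
    exact pow_le_pow_left₀ (by positivity)
      ((mul_le_mul_of_nonneg_left (by linarith) (abs_nonneg _)).trans hfactor) 2
  have hamgm : A * |Z - T ^ 2| ≤ 1 / 2 * A ^ 2 + 1 / 2 * (Z - T ^ 2) ^ 2 := by
    rw [← sq_abs (Z - T ^ 2)]
    linarith [two_mul_le_add_sq A |Z - T ^ 2|]
  linarith [mul_le_mul_of_nonneg_left hsmall hA]

lemma lintegral_sqrt_posPart_sub_sq_le {Ω : Type*} [MeasurableSpace Ω] {μ : Measure Ω}
    [IsProbabilityMeasure μ] {Z : Ω → ℝ} {A K T : ℝ} (hA : 0 < A) (hT : 0 ≤ T)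
    (hZ : Integrable (fun x => (Z x - T ^ 2) ^ 2) μ)
    (h : ∫ x, (Z x - T ^ 2) ^ 2 ∂μ ≤ K * (A ^ 2 + A * T ^ 2)) :
    ∫⁻ x, ENNReal.ofReal ((√(max (Z x) 0) - T) ^ 2) ∂μ
      ≤ ENNReal.ofReal ((1 + 3 * K) / 2 * A) := by
  have hAT : 0 < A + T ^ 2 := by positivity
  have hint : Integrable
      (fun x => (A + T ^ 2)⁻¹ * (1 / 2 * A ^ 2 + 3 / 2 * (Z x - T ^ 2) ^ 2)) μ :=
    ((integrable_const _).add (hZ.const_mul _)).const_mul _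
  calc ∫⁻ x, ENNReal.ofReal ((√(max (Z x) 0) - T) ^ 2) ∂μ
      ≤ ∫⁻ x, ENNReal.ofReal
          ((A + T ^ 2)⁻¹ * (1 / 2 * A ^ 2 + 3 / 2 * (Z x - T ^ 2) ^ 2)) ∂μ :=
        lintegral_mono fun x => ENNReal.ofReal_le_ofReal <|
          (le_inv_mul_iff₀ hAT).2 (mul_sqrt_posPart_sub_sq_le hA.le hT (Z x))
    _ = ENNReal.ofReal
          ((A + T ^ 2)⁻¹ * (1 / 2 * A ^ 2 + 3 / 2 * ∫ x, (Z x - T ^ 2) ^ 2 ∂μ)) := by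
        rw [← ofReal_integral_eq_lintegral_ofReal hint (ae_of_all _ fun x => by positivity),
          integral_const_mul, integral_add (integrable_const (1 / 2 * A ^ 2)) (hZ.const_mul _),
          integral_const_mul (3 / 2), integral_const, probReal_univ, one_smul]
    _ ≤ ENNReal.ofReal ((1 + 3 * K) / 2 * A) := by
        refine ENNReal.ofReal_le_ofReal ((inv_mul_le_iff₀ hAT).2 ?_)
        nlinarith [mul_nonneg hA.le (sq_nonneg T)]

end SquareRoot

section BiasVariance

variable {ι : Type*} [Fintype ι] {Ω : ι → Type*} [∀ i, MeasurableSpace (Ω i)]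
  {μ : ∀ i, Measure (Ω i)} [∀ i, IsProbabilityMeasure (μ i)] {X : ∀ i, Ω i → ℝ}

lemma memLp_sum_pi (hX : ∀ i, MemLp (X i) 2 (μ i)) :
    MemLp (fun ω => ∑ i, X i (ω i)) 2 (Measure.pi μ) :=
  memLp_finsetSum _ fun i _ => (hX i).comp_measurePreserving (measurePreserving_eval μ i)

lemma integral_sum_pi (hX : ∀ i, Integrable (X i) (μ i)) :
    ∫ ω, ∑ i, X i (ω i) ∂(Measure.pi μ) = ∑ i, ∫ x, X i x ∂(μ i) := by
  have hint : ∀ i, Integrable (fun ω => X i (ω i)) (Measure.pi μ) := fun i =>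
    (measurePreserving_eval μ i).integrable_comp_of_integrable (hX i)
  rw [integral_finsetSum _ fun i _ => hint i]
  exact Finset.sum_congr rfl fun i _ => integral_comp_eval (hX i).aestronglyMeasurable

lemma integral_sum_pi_sub_sq_le (hX : ∀ i, MemLp (X i) 2 (μ i)) (a : ι → ℝ) :
    ∫ ω, (∑ i, X i (ω i) - ∑ i, a i) ^ 2 ∂(Measure.pi μ)
      ≤ ∑ i, Var[X i; μ i] + (∑ i, |∫ x, X i x ∂(μ i) - a i|) ^ 2 := by
  have hS := memLp_sum_pi hX
  have hvar : Var[fun ω => ∑ i, X i (ω i); Measure.pi μ] = ∑ i, Var[X i; μ i] := by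
    rw [← variance_sum_pi hX]
    congr 1 with ω
    rw [Finset.sum_apply]
  have hmean : ∫ ω, (∑ i, X i (ω i) - ∑ i, a i) ∂(Measure.pi μ)
      = ∑ i, (∫ x, X i x ∂(μ i) - a i) := by
    rw [integral_sub (hS.integrable one_le_two) (integrable_const _),
      integral_sum_pi fun i => (hX i).integrable one_le_two, integral_const, probReal_univ,
      one_smul, Finset.sum_sub_distrib]
  have hdecomp := variance_eq_sub (hS.sub (memLp_const (∑ i, a i)))
  simp only [Pi.sub_def, Pi.pow_apply] at hdecomp
  rw [variance_sub_const hS.aestronglyMeasurable, hvar, hmean] at hdecomp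
  have hbias : (∑ i, (∫ x, X i x ∂(μ i) - a i)) ^ 2
      ≤ (∑ i, |∫ x, X i x ∂(μ i) - a i|) ^ 2 :=
    sq_le_sq.2 ((Finset.abs_sum_le_sum_abs _ _).trans (le_abs_self _))
  linarith

end BiasVariance

section PlugIn

variable {d : ℕ} {σ A K : ℝ} {h : ℝ → ℝ}

lemma l2Norm_sq (t : Fin d → ℝ) : l2Norm t ^ 2 = ∑ j, t j ^ 2 :=
  Real.sq_sqrt (Finset.sum_nonneg fun _ _ => sq_nonneg _)

lemma lintegral_sqrt_sum_sub_l2Norm_sq_le (hA : 0 < A) {t : Fin d → ℝ}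
    (hh : ∀ j, MemLp h 2 (gaussianReal (t j) 1))
    (hrisk : ∑ j, Var[h; gaussianReal (t j) 1]
      + (∑ j, |∫ x, h x ∂gaussianReal (t j) 1 - t j ^ 2|) ^ 2 ≤ K * (A ^ 2 + A * l2Norm t ^ 2)) :
    ∫⁻ x, ENNReal.ofReal ((√(max (∑ j, h (x j)) 0) - l2Norm t) ^ 2) ∂(gaussianShift t)
      ≤ ENNReal.ofReal ((1 + 3 * K) / 2 * A) := by
  refine lintegral_sqrt_posPart_sub_sq_le hA (Real.sqrt_nonneg _)
    ((memLp_sum_pi hh).sub (memLp_const _)).integrable_sq (le_trans ?_ hrisk)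
  rw [l2Norm_sq]
  exact integral_sum_pi_sub_sq_le hh fun j => t j ^ 2

lemma sqrt_max_sq_mul (hσ : 0 ≤ σ) (Z : ℝ) : √(max (σ ^ 2 * Z) 0) = σ * √(max Z 0) := by
  rw [show max (σ ^ 2 * Z) 0 = σ ^ 2 * max Z 0 by
    rw [mul_max_of_nonneg _ _ (sq_nonneg σ), mul_zero], Real.sqrt_mul (sq_nonneg σ),
    Real.sqrt_sq hσ]

theorem maxRisk_sqrt_posPart_le (hσ : 0 < σ) (hA : 0 < A) {Θ : Set (Fin d → ℝ)}
    {Q : (Fin d → ℝ) → ℝ} (hQ : Measurable Q) (hQσ : ∀ x, Q (σ • x) = σ ^ 2 * ∑ j, h (x j))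
    (hh : ∀ s, MemLp h 2 (gaussianReal s 1))
    (hrisk : ∀ t, σ • t ∈ Θ → ∑ j, Var[h; gaussianReal (t j) 1]
      + (∑ j, |∫ x, h x ∂gaussianReal (t j) 1 - t j ^ 2|) ^ 2
        ≤ K * (A ^ 2 + A * l2Norm t ^ 2)) :
    maxRisk σ l2Norm Θ (fun y => √(max (Q y) 0))
      ≤ ENNReal.ofReal ((1 + 3 * K) / 2 * (σ ^ 2 * A)) := by
  refine maxRisk_le_of_smul hσ (hQ.max measurable_const).sqrt fun t ht => ?_
  calc ∫⁻ x, ENNReal.ofReal ((√(max (Q (σ • x)) 0) - l2Norm (σ • t)) ^ 2) ∂(gaussianShift t)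
      = ∫⁻ x, ENNReal.ofReal (σ ^ 2)
          * ENNReal.ofReal ((√(max (∑ j, h (x j)) 0) - l2Norm t) ^ 2) ∂(gaussianShift t) := by
        congr 1 with x
        rw [hQσ, sqrt_max_sq_mul hσ.le, l2Norm_smul hσ.le, ← mul_sub, mul_pow,
          ENNReal.ofReal_mul (sq_nonneg σ)]
    _ ≤ ENNReal.ofReal (σ ^ 2) * ENNReal.ofReal ((1 + 3 * K) / 2 * A) := by
        rw [lintegral_const_mul' _ _ ENNReal.ofReal_ne_top]
        exact mul_le_mul_right
          (lintegral_sqrt_sum_sub_l2Norm_sq_le hA (fun j => hh (t j)) (hrisk t ht)) _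
    _ = ENNReal.ofReal ((1 + 3 * K) / 2 * (σ ^ 2 * A)) := by
        rw [← ENNReal.ofReal_mul (sq_nonneg σ), mul_left_comm]

end PlugIn

section RiskBounds

variable {d : ℕ}

lemma sum_variance_add_sq_sum_bias_sq_sub_one_le (hd : 1 ≤ d) (t : Fin d → ℝ) :
    ∑ j, Var[fun x => x ^ 2 - 1; gaussianReal (t j) 1]
      + (∑ j, |∫ x, (x ^ 2 - 1) ∂gaussianReal (t j) 1 - t j ^ 2|) ^ 2
        ≤ 8 * (√d ^ 2 + √d * l2Norm t ^ 2) := by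
  have hmean : ∀ s : ℝ, ∫ x, (x ^ 2 - 1) ∂gaussianReal s 1 = s ^ 2 := fun s => by
    rw [integral_sub (integrable_sq_gaussianReal s) (integrable_const _),
      integral_sq_gaussianReal, integral_const, probReal_univ, one_smul, add_sub_cancel_right]
  have hvar : ∀ s : ℝ, Var[fun x => x ^ 2 - 1; gaussianReal s 1] ≤ 8 + 8 * s ^ 2 := fun s => by
    refine (variance_le_integral_sub_sq (by fun_prop) (s ^ 2 - 1)).trans ?_
    simp only [sub_sub_sub_cancel_right]
    linarith [integral_sq_sub_sq_gaussianReal_le s]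
  have hd' : 1 ≤ √(d : ℝ) := Real.one_le_sqrt.2 (by exact_mod_cast hd)
  simp only [hmean, sub_self, abs_zero, Finset.sum_const_zero]
  calc ∑ j, Var[fun x => x ^ 2 - 1; gaussianReal (t j) 1] + 0 ^ 2
      ≤ ∑ j, (8 + 8 * t j ^ 2) + 0 ^ 2 := by gcongr with j; exact hvar _
    _ = 8 * (√d ^ 2 + 1 * l2Norm t ^ 2) := by
        rw [Finset.sum_add_distrib, ← Finset.mul_sum, l2Norm_sq, Real.sq_sqrt d.cast_nonneg]
        simp only [Finset.sum_const, Finset.card_univ, Fintype.card_fin, nsmul_eq_mul]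
        ring
    _ ≤ 8 * (√d ^ 2 + √d * l2Norm t ^ 2) := by gcongr

lemma sum_variance_add_sq_sum_bias_hardStat_le {m L : ℝ} (hm : 1 ≤ m) (hL : 1 / 2 ≤ L)
    (hexp : d * Real.exp (-L) ≤ m ^ 2) {t : Fin d → ℝ}
    (ht : ∑ j, min (t j ^ 2) L ≤ 2 * (m * L)) :
    ∑ j, Var[hardStat √(8 * L); gaussianReal (t j) 1]
      + (∑ j, |∫ x, hardStat √(8 * L) x ∂gaussianReal (t j) 1 - t j ^ 2|) ^ 2
        ≤ 2 ^ 23 * ((m * L) ^ 2 + m * L * l2Norm t ^ 2) := by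
  have hbias : ∑ j, |∫ x, hardStat √(8 * L) x ∂gaussianReal (t j) 1 - t j ^ 2|
      ≤ 2050 * (m * L) := by
    calc _ ≤ ∑ j, 1025 * min (t j ^ 2) L :=
          Finset.sum_le_sum fun j _ => abs_integral_hardStat_sub_sq_le hL (t j)
      _ ≤ 2050 * (m * L) := by rw [← Finset.mul_sum]; linarith
  have hvar : ∑ j, Var[hardStat √(8 * L); gaussianReal (t j) 1]
      ≤ 512 * (m * L) ^ 2 + 592 * (m * L * l2Norm t ^ 2) := by
    calc _ ≤ ∑ j, (512 * (L ^ 2 * Real.exp (-L)) + 592 * (L * t j ^ 2)) :=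
          Finset.sum_le_sum fun j _ => variance_hardStat_le hL (t j)
      _ = 512 * (L ^ 2 * (d * Real.exp (-L))) + 592 * (1 * L * l2Norm t ^ 2) := by
          rw [Finset.sum_add_distrib, Finset.sum_const, Finset.card_univ, Fintype.card_fin,
            nsmul_eq_mul, ← Finset.mul_sum, ← Finset.mul_sum, l2Norm_sq]
          ring
      _ ≤ 512 * (L ^ 2 * m ^ 2) + 592 * (m * L * l2Norm t ^ 2) := by gcongr
      _ = 512 * (m * L) ^ 2 + 592 * (m * L * l2Norm t ^ 2) := by ring
  have hbias_sq := pow_le_pow_left₀ (Finset.sum_nonneg fun j _ => abs_nonneg _) hbias 2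
  have hcross : 0 ≤ m * L * l2Norm t ^ 2 := by positivity
  linarith [sq_nonneg (m * L), mul_pow 2050 (m * L) 2]

end RiskBounds

section EffectiveSparsity

variable {d m : ℕ} {q r σ : ℝ}

lemma sparsityIneq_of_le_effSparsity {k : ℕ} (hk : 1 ≤ k)
    (h : (k : ℕ∞) ≤ effSparsity d q r σ) : SparsityIneq d q r σ k := by
  obtain ⟨n, rfl⟩ : ∃ n, k = n + 1 := ⟨k - 1, by lia⟩
  have hlt : (n : ℕ∞) < effSparsity d q r σ :=
    lt_of_lt_of_le (by exact_mod_cast n.lt_succ_self) h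
  simp only [effSparsity, lt_iSup_iff] at hlt
  obtain ⟨s, hs, hns⟩ := hlt
  exact hs _ hk (by exact_mod_cast hns)

lemma not_sparsityIneq_of_effSparsity_eq (h : effSparsity d q r σ = m) :
    ¬ SparsityIneq d q r σ (m + 1) := by
  intro hsucc
  have hle : ((m + 1 : ℕ) : ℕ∞) ≤ effSparsity d q r σ := by
    refine le_iSup₂_of_le (m + 1) (fun k hk hkm => ?_) le_rfl
    rcases hkm.eq_or_lt with rfl | hlt
    · exact hsucc
    · refine sparsityIneq_of_le_effSparsity hk ?_
      rw [h]
      exact_mod_cast Nat.lt_succ_iff.1 hlt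
  rw [h] at hle
  exact m.lt_irrefl (by exact_mod_cast hle)

lemma effSparsity_cases (d : ℕ) (q r σ : ℝ) : (d : ℕ∞) < effSparsity d q r σ ^ 2 ∨
    (∃ m : ℕ, 1 ≤ m ∧ m ^ 2 ≤ d ∧ effSparsity d q r σ = m) ∨ effSparsity d q r σ = 0 := by
  rcases lt_or_ge (d : ℕ∞) (effSparsity d q r σ ^ 2) with h | h
  · exact Or.inl h
  have hne : effSparsity d q r σ ≠ ⊤ := fun htop => by simp [htop] at h
  obtain ⟨m, hm⟩ := ENat.ne_top_iff_exists.1 hne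
  rw [← hm] at h ⊢
  rcases m.eq_zero_or_pos with rfl | hpos
  · exact Or.inr (Or.inr rfl)
  · exact Or.inr (Or.inl ⟨m, hpos, by exact_mod_cast h, rfl⟩)

lemma sqrt_le_effSparsity (h : (d : ℕ∞) < effSparsity d q r σ ^ 2) :
    (d.sqrt : ℕ∞) ≤ effSparsity d q r σ := by
  by_contra! hlt
  have hsq : (d : ℕ∞) < (d.sqrt : ℕ∞) ^ 2 := h.trans_le (pow_le_pow_left' hlt.le 2)
  exact absurd (Nat.sqrt_le' d) (not_le.2 (by exact_mod_cast hsq))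

lemma rate_of_lt (h : (d : ℕ∞) < effSparsity d q r σ ^ 2) : rate d q r σ = σ ^ 2 * √d := if_pos h

lemma rate_of_eq (hm : 1 ≤ m) (hmd : m ^ 2 ≤ d) (h : effSparsity d q r σ = m) :
    rate d q r σ = σ ^ 2 * (m * Real.log (1 + d / (m : ℝ) ^ 2)) := by
  rw [rate, h, if_neg (not_lt.2 (by exact_mod_cast hmd)), if_pos (by exact_mod_cast hm),
    ENat.toNat_natCast, mul_assoc]

lemma rate_of_eq_zero (h : effSparsity d q r σ = 0) : rate d q r σ = r ^ 2 := by
  simp [rate, h]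

lemma rate_nonneg (d : ℕ) (q r σ : ℝ) : 0 ≤ rate d q r σ := by
  have hlog (x : ℝ) : 0 ≤ Real.log (1 + d / x ^ 2) :=
    Real.log_nonneg (le_add_of_nonneg_right (by positivity))
  unfold rate
  split_ifs
  · positivity
  · exact mul_nonneg (by positivity) (hlog _)
  · positivity

lemma half_le_log (hm : 1 ≤ m) (hmd : m ^ 2 ≤ d) :
    1 / 2 ≤ Real.log (1 + d / (m : ℝ) ^ 2) := by
  have : (0 : ℝ) < m := by exact_mod_cast hm
  have hratio : (1 : ℝ) ≤ d / (m : ℝ) ^ 2 :=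
    (one_le_div (by positivity)).2 (by exact_mod_cast hmd)
  linarith [Real.log_two_gt_d9, Real.log_le_log two_pos (by linarith : 2 ≤ 1 + d / (m : ℝ) ^ 2)]

lemma mul_exp_neg_log_le (hm : 1 ≤ m) :
    d * Real.exp (-Real.log (1 + d / (m : ℝ) ^ 2)) ≤ (m : ℝ) ^ 2 := by
  have : (0 : ℝ) < m := by exact_mod_cast hm
  rw [Real.exp_neg, Real.exp_log (by positivity), ← div_eq_mul_inv, div_le_iff₀ (by positivity),
    mul_add, mul_div_cancel₀ _ (by positivity)]
  exact le_add_of_nonneg_left (by positivity)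

lemma sum_min_sq_le_of_not_sparsityIneq (hq : 0 < q) (hq₂ : q ≤ 2) (hr : 0 ≤ r) (hσ : 0 < σ)
    (hd : 1 ≤ d) (hm : 1 ≤ m) (h : ¬ SparsityIneq d q r σ (m + 1)) {θ : Fin d → ℝ}
    (hθ : θ ∈ lqBall d q r) :
    ∑ j, min (θ j ^ 2) (σ ^ 2 * Real.log (1 + d / (m : ℝ) ^ 2))
      ≤ (m + 1) * (σ ^ 2 * Real.log (1 + d / (m : ℝ) ^ 2)) := by
  have hd' : (0 : ℝ) < d := by exact_mod_cast hd
  have hm' : (0 : ℝ) < m := by exact_mod_cast hm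
  have hlog {x : ℝ} (hx : 0 < x) : 0 < Real.log (1 + d / x ^ 2) :=
    Real.log_pos (lt_add_of_pos_right 1 (by positivity))
  set u := σ ^ 2 * Real.log (1 + d / (m : ℝ) ^ 2) with hu
  set v := σ ^ 2 * Real.log (1 + d / (m + 1 : ℝ) ^ 2) with hv
  have hu₀ : 0 < u := mul_pos (by positivity) (hlog hm')
  have hv₀ : 0 < v := mul_pos (by positivity) (hlog (by positivity))
  have hvu : v ≤ u := by
    rw [hu, hv]
    gcongr
    exact le_add_of_nonneg_right zero_le_one
  have hfail : r ^ q < (m + 1) * v ^ (q / 2) := by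
    rw [SparsityIneq, Nat.cast_succ, ← hv,
      le_sq_mul_rpow_iff hq hr (by positivity) hv₀.le] at h
    exact not_le.1 h
  calc ∑ j, min (θ j ^ 2) u ≤ r ^ q * u ^ (1 - q / 2) := sum_min_sq_le hq hq₂ hr hθ hu₀
    _ ≤ ((m + 1) * u ^ (q / 2)) * u ^ (1 - q / 2) := by
        gcongr
        exact hfail.le.trans (by gcongr)
    _ = (m + 1) * u := by rw [mul_assoc, ← Real.rpow_add hu₀, add_sub_cancel, Real.rpow_one]

lemma sum_min_sq_le_of_effSparsity_eq (hq : 0 < q) (hq₂ : q ≤ 2) (hr : 0 ≤ r) (hσ : 0 < σ)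
    (hm : 1 ≤ m) (hmd : m ^ 2 ≤ d) (h : effSparsity d q r σ = m) {t : Fin d → ℝ}
    (ht : σ • t ∈ lqBall d q r) :
    ∑ j, min (t j ^ 2) (Real.log (1 + d / (m : ℝ) ^ 2))
      ≤ 2 * (m * Real.log (1 + d / (m : ℝ) ^ 2)) := by
  have hL := half_le_log hm hmd
  have hsum := sum_min_sq_le_of_not_sparsityIneq hq hq₂ hr hσ (by nlinarith) hm
    (not_sparsityIneq_of_effSparsity_eq h) ht
  set L := Real.log (1 + d / (m : ℝ) ^ 2)
  have hm' : (1 : ℝ) ≤ m := by exact_mod_cast hm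
  have hscale : σ ^ 2 * ∑ j, min (t j ^ 2) L ≤ σ ^ 2 * ((m + 1) * L) := by
    simpa only [Pi.smul_apply, smul_eq_mul, mul_pow, Finset.mul_sum,
      mul_min_of_nonneg _ _ (sq_nonneg σ), mul_left_comm (σ ^ 2)] using hsum
  nlinarith [le_of_mul_le_mul_left hscale (by positivity)]

end EffectiveSparsity

section Estimator

variable {d m : ℕ} {q r σ : ℝ}

lemma measurable_quadStat (d : ℕ) (q r σ : ℝ) : Measurable (quadStat d q r σ) := by
  unfold quadStat
  split_ifs
  · fun_prop
  · exact Finset.measurable_fun_sum _ fun j _ => Measurable.ite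
      (measurableSet_lt measurable_const (by fun_prop)) (by fun_prop) measurable_const
  · exact measurable_const

lemma measurable_normStat (d : ℕ) (q r σ : ℝ) : Measurable (normStat d q r σ) :=
  ((measurable_quadStat d q r σ).max measurable_const).sqrt

lemma condSecondMoment_eq_tailMoment (d m : ℕ) :
    condSecondMoment d m = tailMoment √(8 * Real.log (1 + d / (m : ℝ) ^ 2)) := by
  have hL : 0 ≤ Real.log (1 + d / (m : ℝ) ^ 2) :=
    Real.log_nonneg (le_add_of_nonneg_right (by positivity))
  rw [condSecondMoment, tailMoment]
  congr 2 with x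
  rw [Set.mem_ofPred_eq, Set.mem_ofPred_eq, ← Real.sqrt_sq_eq_abs,
    Real.sqrt_lt_sqrt_iff (by positivity)]

lemma quadStat_smul_of_lt (h : (d : ℕ∞) < effSparsity d q r σ ^ 2) (x : Fin d → ℝ) :
    quadStat d q r σ (σ • x) = σ ^ 2 * ∑ j, (x j ^ 2 - 1) := by
  simp only [quadStat, if_pos h, Pi.smul_apply, smul_eq_mul, mul_pow, ← Finset.mul_sum,
    Finset.sum_sub_distrib, Finset.sum_const, Finset.card_univ, Fintype.card_fin, nsmul_eq_mul,
    mul_one]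
  ring

lemma quadStat_smul_of_eq (hσ : 0 < σ) (hm : 1 ≤ m) (hmd : m ^ 2 ≤ d)
    (h : effSparsity d q r σ = m) (x : Fin d → ℝ) :
    quadStat d q r σ (σ • x)
      = σ ^ 2 * ∑ j, hardStat √(8 * Real.log (1 + d / (m : ℝ) ^ 2)) (x j) := by
  rw [quadStat, h, if_neg (not_lt.2 (by exact_mod_cast hmd)), if_pos (by exact_mod_cast hm),
    ENat.toNat_natCast, condSecondMoment_eq_tailMoment, Finset.mul_sum]
  refine Finset.sum_congr rfl fun j _ => ?_
  set L := Real.log (1 + d / (m : ℝ) ^ 2)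
  have hthreshold : 2 * σ * √(2 * L) = σ * √(8 * L) := by
    rw [show 8 * L = 2 ^ 2 * (2 * L) by ring, Real.sqrt_mul (by norm_num) (2 * L),
      Real.sqrt_sq zero_le_two]
    ring
  simp only [hthreshold, Pi.smul_apply, smul_eq_mul, abs_mul, abs_of_pos hσ,
    mul_lt_mul_iff_right₀ hσ, hardStat, Set.indicator_apply, Set.mem_ofPred_eq]
  split_ifs <;> ring

lemma quadStat_of_eq_zero (h : effSparsity d q r σ = 0) (y : Fin d → ℝ) :
    quadStat d q r σ y = 0 := by
  simp [quadStat, h]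

end Estimator

section UpperBound

variable {d m : ℕ} {q r σ : ℝ}

lemma maxRisk_normStat_le_of_lt (hd : 1 ≤ d) (hσ : 0 < σ)
    (h : (d : ℕ∞) < effSparsity d q r σ ^ 2) (Θ : Set (Fin d → ℝ)) :
    maxRisk σ l2Norm Θ (normStat d q r σ) ≤ ENNReal.ofReal ((1 + 3 * 8) / 2 * rate d q r σ) := by
  have hd' : (0 : ℝ) < d := by exact_mod_cast hd
  rw [rate_of_lt h]
  exact maxRisk_sqrt_posPart_le hσ (Real.sqrt_pos.2 hd')
    (measurable_quadStat d q r σ) (quadStat_smul_of_lt h)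
    (fun s => memLp_two_gaussianReal_of_abs_le (C := 1) (by fun_prop) fun x =>
      abs_le.2 ⟨by linarith [sq_nonneg x], by linarith⟩)
    fun t _ => sum_variance_add_sq_sum_bias_sq_sub_one_le hd t

lemma maxRisk_normStat_le_of_eq (hq : 0 < q) (hq₂ : q ≤ 2) (hr : 0 ≤ r) (hσ : 0 < σ)
    (hm : 1 ≤ m) (hmd : m ^ 2 ≤ d) (h : effSparsity d q r σ = m) :
    maxRisk σ l2Norm (lqBall d q r) (normStat d q r σ)
      ≤ ENNReal.ofReal ((1 + 3 * 2 ^ 23) / 2 * rate d q r σ) := by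
  have hL := half_le_log hm hmd
  have hm' : (1 : ℝ) ≤ m := by exact_mod_cast hm
  rw [rate_of_eq hm hmd h]
  exact maxRisk_sqrt_posPart_le hσ (by positivity) (measurable_quadStat d q r σ)
    (quadStat_smul_of_eq hσ hm hmd h) (memLp_hardStat (two_le_sqrt_eight_mul hL))
    fun t ht => sum_variance_add_sq_sum_bias_hardStat_le hm' hL (mul_exp_neg_log_le hm)
      (sum_min_sq_le_of_effSparsity_eq hq hq₂ hr hσ hm hmd h ht)

lemma maxRisk_normStat_le_of_eq_zero (hq : 0 < q) (hq₂ : q ≤ 2) (hr : 0 < r)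
    (h : effSparsity d q r σ = 0) :
    maxRisk σ l2Norm (lqBall d q r) (normStat d q r σ) ≤ ENNReal.ofReal (rate d q r σ) := by
  refine iSup₂_le fun θ hθ => ?_
  have : IsProbabilityMeasure (obsLaw σ θ) :=
    Measure.isProbabilityMeasure_map (Measurable.aemeasurable (by fun_prop))
  have hzero (y : Fin d → ℝ) : normStat d q r σ y = 0 := by
    rw [normStat, quadStat_of_eq_zero h, max_self, Real.sqrt_zero]
  simp only [sqRisk, hzero, zero_sub, neg_sq, lintegral_const, measure_univ, mul_one]
  rw [rate_of_eq_zero h, l2Norm_sq]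
  exact ENNReal.ofReal_le_ofReal (sum_sq_le_of_mem_lqBall hq hq₂ hr hθ)

theorem maxRisk_normStat_le (hq : 0 < q) (hq₂ : q ≤ 2) (hd : 1 ≤ d) (hr : 0 < r) (hσ : 0 < σ) :
    maxRisk σ l2Norm (lqBall d q r) (normStat d q r σ)
      ≤ ENNReal.ofReal (2 ^ 24 * rate d q r σ) := by
  have hψ := rate_nonneg d q r σ
  rcases effSparsity_cases d q r σ with h | ⟨m, hm, hmd, h⟩ | h
  · exact (maxRisk_normStat_le_of_lt hd hσ h _).trans (ENNReal.ofReal_le_ofReal (by linarith))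
  · exact (maxRisk_normStat_le_of_eq hq hq₂ hr.le hσ hm hmd h).trans
      (ENNReal.ofReal_le_ofReal (by linarith))
  · exact (maxRisk_normStat_le_of_eq_zero hq hq₂ hr h).trans
      (ENNReal.ofReal_le_ofReal (by linarith))

end UpperBound

section RateLowerBound

variable {d : ℕ} {q r σ : ℝ}

lemma le_minimaxRisk_of_sparsityIneq {k : ℕ} (hq : 0 < q) (hr : 0 ≤ r) (hk : 1 ≤ k)
    (hkd : k ^ 2 ≤ d) (h : SparsityIneq d q r σ k) :
    ENNReal.ofReal (σ ^ 2 * (k * Real.log (1 + d / (k : ℝ) ^ 2)) / 24)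
      ≤ minimaxRisk σ l2Norm (lqBall d q r) := by
  have hL := half_le_log hk hkd
  rw [SparsityIneq] at h
  set L := Real.log (1 + d / (k : ℝ) ^ 2)
  have ha : √(L / 4) ^ 2 = L / 4 := Real.sq_sqrt (by linarith)
  have hσa : (σ * √(L / 4)) ^ 2 = σ ^ 2 * L / 4 := by rw [mul_pow, ha, mul_div_assoc]
  refine le_trans (le_of_eq ?_) (le_minimaxRisk_of_spikes hq hr hk hkd ha.le ?_)
  · rw [hσa]
    ring_nf
  · rw [hσa]
    linarith [mul_nonneg (sq_nonneg σ) (one_half_pos.le.trans hL)]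

lemma rate_div_le_minimaxRisk_of_lt (hq : 0 < q) (hr : 0 ≤ r) (hd : 1 ≤ d)
    (h : (d : ℕ∞) < effSparsity d q r σ ^ 2) :
    ENNReal.ofReal (rate d q r σ / 96) ≤ minimaxRisk σ l2Norm (lqBall d q r) := by
  have hk : 1 ≤ d.sqrt := Nat.le_sqrt.2 (by simpa using hd)
  have hkd : d.sqrt ^ 2 ≤ d := Nat.sqrt_le' d
  have hL := half_le_log hk hkd
  refine le_trans (ENNReal.ofReal_le_ofReal ?_) (le_minimaxRisk_of_sparsityIneq hq hr hk hkd
    (sparsityIneq_of_le_effSparsity hk (sqrt_le_effSparsity h)))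
  have hsqrt : √(d : ℝ) ≤ 2 * d.sqrt := by
    refine Real.sqrt_le_iff.2 ⟨by positivity, ?_⟩
    have hlt : d < (d.sqrt + 1) ^ 2 := Nat.lt_succ_sqrt' d
    exact_mod_cast (show d ≤ (2 * d.sqrt) ^ 2 by nlinarith)
  rw [rate_of_lt h]
  set L := Real.log (1 + d / (d.sqrt : ℝ) ^ 2)
  have hbound : √(d : ℝ) ≤ 4 * (d.sqrt * L) :=
    hsqrt.trans (by nlinarith [Nat.cast_nonneg (α := ℝ) d.sqrt])
  linarith [mul_le_mul_of_nonneg_left hbound (sq_nonneg σ)]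

lemma rate_div_le_minimaxRisk_of_eq {m : ℕ} (hq : 0 < q) (hr : 0 ≤ r) (hm : 1 ≤ m)
    (hmd : m ^ 2 ≤ d) (h : effSparsity d q r σ = m) :
    ENNReal.ofReal (rate d q r σ / 24) ≤ minimaxRisk σ l2Norm (lqBall d q r) := by
  rw [rate_of_eq hm hmd h]
  exact le_minimaxRisk_of_sparsityIneq hq hr hm hmd (sparsityIneq_of_le_effSparsity hm h.ge)

lemma rate_div_le_minimaxRisk_of_eq_zero (hq : 0 < q) (hr : 0 ≤ r) (hσ : 0 < σ) (hd : 1 ≤ d)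
    (h : effSparsity d q r σ = 0) :
    ENNReal.ofReal (rate d q r σ / 24) ≤ minimaxRisk σ l2Norm (lqBall d q r) := by
  have hfail : ¬ SparsityIneq d q r σ 1 := not_sparsityIneq_of_effSparsity_eq (m := 0) h
  simp only [SparsityIneq, Nat.cast_one, one_pow, div_one, Real.one_rpow, mul_one, not_le]
    at hfail
  have hσa : (σ * (r / (2 * σ))) ^ 2 = r ^ 2 / 4 := by
    field_simp
    norm_num
  refine le_trans (le_of_eq ?_) (le_minimaxRisk_of_spikes (k := 1) (a := r / (2 * σ)) hq hr le_rfl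
    (by simpa using hd) ?_ ?_)
  · rw [rate_of_eq_zero h, hσa, Nat.cast_one]
    ring_nf
  · rw [div_pow, div_le_iff₀ (by positivity), Nat.cast_one, one_pow, div_one]
    linarith
  · rw [hσa, Nat.cast_one, Real.one_rpow]
    linarith [sq_nonneg r]

theorem rate_div_le_minimaxRisk (hq : 0 < q) (hr : 0 ≤ r) (hσ : 0 < σ) (hd : 1 ≤ d) :
    ENNReal.ofReal (rate d q r σ / 96) ≤ minimaxRisk σ l2Norm (lqBall d q r) := by
  have hψ : ENNReal.ofReal (rate d q r σ / 96) ≤ ENNReal.ofReal (rate d q r σ / 24) :=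
    ENNReal.ofReal_le_ofReal (by linarith [rate_nonneg d q r σ])
  rcases effSparsity_cases d q r σ with h | ⟨m, hm, hmd, h⟩ | h
  · exact rate_div_le_minimaxRisk_of_lt hq hr hd h
  · exact hψ.trans (rate_div_le_minimaxRisk_of_eq hq hr hm hmd h)
  · exact hψ.trans (rate_div_le_minimaxRisk_of_eq_zero hq hr hσ hd h)

end RateLowerBound

end SparseNorm

theorem theorem7_general :
    ∃ C c : ℝ, 0 < C ∧ 0 < c ∧
      ∀ (q : ℝ), 0 < q → q ≤ 2 → ∀ (d : ℕ) (r σ : ℝ), 1 ≤ d → 0 < r → 0 < σ →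
        Measurable (SparseNorm.normStat d q r σ) ∧
        SparseNorm.maxRisk σ SparseNorm.l2Norm (SparseNorm.lqBall d q r)
            (SparseNorm.normStat d q r σ) ≤
          ENNReal.ofReal (C * SparseNorm.rate d q r σ) ∧
        ENNReal.ofReal (c * SparseNorm.rate d q r σ) ≤
          SparseNorm.minimaxRisk σ SparseNorm.l2Norm (SparseNorm.lqBall d q r) := by
  refine ⟨2 ^ 24, 96⁻¹, by norm_num, by norm_num, fun q hq hq₂ d r σ hd hr hσ =>
    ⟨SparseNorm.measurable_normStat d q r σ, SparseNorm.maxRisk_normStat_le hq hq₂ hd hr hσ, ?_⟩⟩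
  rw [inv_mul_eq_div]
  exact SparseNorm.rate_div_le_minimaxRisk hq hr.le hσ hd

theorem theorem7 (q : ℝ) (hq0 : 0 < q) (hq2 : q < 2) :
    ∃ C c : ℝ, 0 < C ∧ 0 < c ∧
      ∀ (d : ℕ) (r σ : ℝ), 1 ≤ d → 0 < r → 0 < σ →
        Measurable (SparseNorm.normStat d q r σ) ∧
        SparseNorm.maxRisk σ SparseNorm.l2Norm (SparseNorm.lqBall d q r)
            (SparseNorm.normStat d q r σ) ≤
          ENNReal.ofReal (C * SparseNorm.rate d q r σ) ∧
        ENNReal.ofReal (c * SparseNorm.rate d q r σ) ≤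
          SparseNorm.minimaxRisk σ SparseNorm.l2Norm (SparseNorm.lqBall d q r) := by
  obtain ⟨C, c, hC, hc, h⟩ := theorem7_general
  exact ⟨C, c, hC, hc, h q hq0 hq2.le⟩
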